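/- Let $N,T\ge 1$, let $\mathbf F_G\in\mathbb C^{N\times N}$ be an arbitrary invertible matrix (the graph Fourier transform matrix of a graph $\mathcal G$ on $N$ vertices), and let $\mathbf F\in\mathbb C^{T\times T}$ be the normalized DFT matrix, $\mathbf F_{m,n}=\frac1{\sqrt T}e^{-2\pi j mn/T}$, $0\le m,n\le T-1$. For $\mathbf X\in\mathbb C^{N\times T}$ the joint time-vertex Fourier transform is $\mathrm{JFT}(\mathbf X;\mathcal G)=\mathbf F_G\,\mathbf X\,\mathbf F^{\mathsf T}$. *Graph fractional Fourier transform.* Let $\mathbf F_G=\mathbf P\mathbf J\mathbf P^{-1}$ be a Jordan decomposition. For $\beta\in\mathbb R$ put $\mathbf F_G^{\beta}=\mathbf P\mathbf J^{\beta}\mathbf P^{-1}$, where $\mathbf J^\beta$ is formed block by block: the power of a Jordan block with eigenvalue $\lambda$ is upper triangular with the entry $\prod_{n=1}^{k}\frac{\beta+1-n}{n}\,\lambda^{\beta-k}$ (principal power) on its $k$-th superdiagonal, $k\ge 0$. *Discrete fractional Fourier transform.* Let $\mathbf S$ be the real symmetric operator on $\mathbb R^T$ (indices modulo $T$) given by $(\mathbf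 S f)[n]=f[n+1]-2f[n]+f[n-1]+\bigl(2\cos\tfrac{2\pi n}{T}-2\bigr)f[n]$. It preserves the space of even signals ($f[-n]=f[n]$) and the space of odd signals ($f[-n]=-f[n]$). Let $\mathbf u_0,\mathbf u_2,\mathbf u_4,\dots$ and $\mathbf u_1,\mathbf u_3,\mathbf u_5,\dots$ (the discrete Hermite-Gaussians) be orthonormal bases of real eigenvectors of $\mathbf S$ on the even and on the odd signals respectively, each listed by decreasing eigenvalue. For $\alpha\in\mathbb R$ put $$\mathbf F^{\alpha}[m,n]=\sum_{\substack{0\le k\le T\\ k\ne T-1+(T \bmod 2)}}\mathbf u_k[m]\,e^{-j\frac{\pi}{2}k\alpha}\,\mathbf u_k[n].$$ *Joint fractional transform.* For $\alpha,\beta\in\mathbb R$ put $\mathrm{JFT}^{\alpha,\beta}(\mathbf X;\mathcal G)=\mathbf F_G^{\beta}\,\mathbf X\,(\mathbf F^{\alpha})^{\mathsf T}$. Then, for every Jordan decomposition of $\mathbf F_G$ and every $\mathbf X\in\mathbb C^{N\times T}$, $$\mathrm{JFT}^{1,1}(\mathbf X;\mathcal G)=\mathbf F_G\,\mathbf X\,\mathbf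 F^{\mathsf T}=\mathrm{JFT}(\mathbf X;\mathcal G),$$ so the ordinary joint time-vertex Fourier transform is the special case of order $(1,1)$ of the joint fractional one. -/

import Mathlib

noncomputable section

namespace JointFourier

open Complex (I exp)
open scoped Matrix

/-! ### The discrete Fourier transform and its commuting matrix -/

/-- The normalized (unitary) `T`-point DFT matrix, `F m n = T^(-1/2) exp (-2π j m n / T)`. -/
def dftMatrix (T : ℕ) : Matrix (Fin T) (Fin T) ℂ :=
  Matrix.of fun m n =>
    (1 / (Real.sqrt T : ℂ)) * exp (-I * 2 * Real.pi * (m : ℕ) * (n : ℕ) / T)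

/-- The real symmetric matrix `S` commuting with the DFT, whose eigenvectors are the discrete
Hermite-Gaussians: the periodic second difference plus its DFT conjugate,
`(S f) n = (f (n+1) - 2 f n + f (n-1)) + (2 cos (2π n / T) - 2) f n`, indices modulo `T`
(addition in `Fin T` is modulo `T`; for `T ≤ 2` the two neighbours coincide and are both counted).
It is the discrete analogue of the Hermite operator `D² - 4π² t²`. -/
def hermiteMatrix (T : ℕ) [NeZero T] : Matrix (Fin T) (Fin T) ℝ :=
  Matrix.of fun m n =>
    (if n = m + 1 then 1 else 0) + (if n = m - 1 then 1 else 0) +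
      (if n = m then 2 * Real.cos (2 * Real.pi * (m : ℕ) / T) - 4 else 0)

/-- `S` as an operator on `ℝ^T` with the Euclidean inner product. -/
def hermiteOp (T : ℕ) [NeZero T] :
    EuclideanSpace ℝ (Fin T) →ₗ[ℝ] EuclideanSpace ℝ (Fin T) :=
  Matrix.toEuclideanLin (hermiteMatrix T)

/-- The space of signals with the parity of `k`, i.e. `x (-n) = (-1)^k x n` with `-n` modulo `T`:
the even signals if `k` is even, the odd signals if `k` is odd. -/
def paritySpace (T : ℕ) [NeZero T] (k : ℕ) : Submodule ℝ (EuclideanSpace ℝ (Fin T)) where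
  carrier := {x | ∀ n, x (-n) = (-1) ^ k * x n}
  add_mem' {x y} hx hy n := by
    simp only [PiLp.add_apply, hx n, hy n, mul_add]
  zero_mem' n := by simp
  smul_mem' c x hx n := by
    simp only [PiLp.smul_apply, hx n, smul_eq_mul]; ring

theorem hermiteOp_apply (T : ℕ) [NeZero T] (x : EuclideanSpace ℝ (Fin T)) (m : Fin T) :
    hermiteOp T x m =
      x (m + 1) + x (m - 1) + (2 * Real.cos (2 * Real.pi * (m : ℕ) / T) - 4) * x m := by
  simp [hermiteOp, hermiteMatrix, Matrix.toLpLin_apply, Matrix.mulVec, dotProduct, add_mul,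
    Finset.sum_add_distrib]

theorem hermiteMatrix_isHermitian (T : ℕ) [NeZero T] : (hermiteMatrix T).IsHermitian := by
  ext m n
  have h1 : m = n + 1 ↔ n = m - 1 := ⟨fun h => by simp [h], fun h => by simp [h]⟩
  have h2 : m = n - 1 ↔ n = m + 1 := ⟨fun h => by simp [h], fun h => by simp [h]⟩
  simp only [hermiteMatrix, Matrix.conjTranspose_apply, Matrix.of_apply, star_trivial, h1, h2]
  by_cases h : n = m
  · subst h; ring
  · simp [h, Ne.symm h, add_comm]

theorem hermiteOp_isSymmetric (T : ℕ) [NeZero T] : (hermiteOp T).IsSymmetric :=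
  Matrix.isSymmetric_toEuclideanLin_iff.mpr (hermiteMatrix_isHermitian T)

theorem cos_neg_index (T : ℕ) [NeZero T] (n : Fin T) :
    Real.cos (2 * Real.pi * ((-n : Fin T) : ℕ) / T) = Real.cos (2 * Real.pi * (n : ℕ) / T) := by
  have hT : (T : ℝ) ≠ 0 := Nat.cast_ne_zero.mpr (NeZero.ne T)
  by_cases h : n = 0
  · simp [h]
  · have hv : ((-n : Fin T) : ℕ) = T - n := by
      rw [Fin.val_neg]; simp [h]
    rw [hv, Nat.cast_sub n.isLt.le, ← Real.cos_two_pi_sub]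
    congr 1
    field_simp
    ring

theorem hermiteOp_mem_paritySpace (T : ℕ) [NeZero T] (k : ℕ) :
    ∀ x ∈ paritySpace T k, hermiteOp T x ∈ paritySpace T k := by
  intro x hx n
  have hx' : ∀ n, x (-n) = (-1) ^ k * x n := hx
  have e1 : -n + 1 = -(n - 1) := by abel
  have e2 : -n - 1 = -(n + 1) := by abel
  rw [hermiteOp_apply, hermiteOp_apply, cos_neg_index, e1, e2, hx', hx', hx']
  ring

/-- The restriction of `S` to the signals with the parity of `k`. -/
def hermiteOpParity (T : ℕ) [NeZero T] (k : ℕ) : paritySpace T k →ₗ[ℝ] paritySpace T k :=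
  (hermiteOp T).restrict (hermiteOp_mem_paritySpace T k)

theorem hermiteOpParity_isSymmetric (T : ℕ) [NeZero T] (k : ℕ) :
    (hermiteOpParity T k).IsSymmetric :=
  (hermiteOp_isSymmetric T).restrict_invariant (hermiteOp_mem_paritySpace T k)

/-! ### The discrete fractional Fourier transform -/

/-- The `k`-th discrete Hermite-Gaussian: the even ones `u₀, u₂, u₄, …` (odd ones `u₁, u₃, u₅, …`)
are the orthonormal eigenvectors of `S` on the even (odd) signals, listed by decreasing eigenvalue.
(`LinearMap.IsSymmetric.eigenvectorBasis` is sorted in this way.)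
The value is `0` if there is no such eigenvector, which never happens for an index occurring in
`dfrtMatrix`. On each parity class the eigenvalues of `S` are simple, so `u k` is determined up
to a sign, on which `dfrtMatrix` does not depend. -/
def discreteHermiteGaussian (T : ℕ) [NeZero T] (k : ℕ) : EuclideanSpace ℝ (Fin T) :=
  if h : k / 2 < Module.finrank ℝ (paritySpace T k) then
    ((hermiteOpParity_isSymmetric T k).eigenvectorBasis rfl ⟨k / 2, h⟩ : paritySpace T k)
  else 0

/-- The DFRT matrix of order `α`:
`F^α m n = ∑_{k = 0, k ≠ T - 1 + (T mod 2)}^{T} u_k m * exp (-j (π/2) k α) * u_k n`. -/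
def dfrtMatrix (T : ℕ) [NeZero T] (α : ℝ) : Matrix (Fin T) (Fin T) ℂ :=
  Matrix.of fun m n =>
    ∑ k ∈ (Finset.range (T + 1)).erase (T - 1 + T % 2),
      (discreteHermiteGaussian T k m : ℂ) * exp (-I * (Real.pi / 2) * k * α) *
        (discreteHermiteGaussian T k n : ℂ)

/-! ### The graph fractional Fourier transform -/

/-- The `m × m` (upper) Jordan block with eigenvalue `μ`. -/
def jordanBlock (m : ℕ) (μ : ℂ) : Matrix (Fin m) (Fin m) ℂ :=
  Matrix.of fun a b => if a = b then μ else if (a : ℕ) + 1 = b then 1 else 0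

/-- The power of order `α` of a Jordan block: upper triangular Toeplitz, with
`∏_{n=1}^{k} (α + 1 - n) / n * μ^(α - k)` on the `k`-th superdiagonal (principal powers). -/
def jordanBlockPow (m : ℕ) (μ : ℂ) (α : ℝ) : Matrix (Fin m) (Fin m) ℂ :=
  Matrix.of fun a b =>
    if a ≤ b then
      (∏ n ∈ Finset.Icc 1 ((b : ℕ) - a), ((α : ℂ) + 1 - n) / n) *
        μ ^ ((α : ℂ) - ((b : ℕ) - a : ℕ))
    else 0

/-- A Jordan decomposition `A = P J P⁻¹`. The rows and columns of `J` and the columns of `P` are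
indexed by the pairs (block, position in the block). -/
structure JordanDecomposition {N : ℕ} (A : Matrix (Fin N) (Fin N) ℂ) where
  numBlocks : ℕ
  size : Fin numBlocks → ℕ
  size_pos : ∀ i, 0 < size i
  eigenvalue : Fin numBlocks → ℂ
  P : Matrix (Fin N) (Σ i, Fin (size i)) ℂ
  Pinv : Matrix (Σ i, Fin (size i)) (Fin N) ℂ
  P_mul_Pinv : P * Pinv = 1
  Pinv_mul_P : Pinv * P = 1
  eq_mul : A = P * Matrix.blockDiagonal' (fun i => jordanBlock (size i) (eigenvalue i)) * Pinv

/-- The GFRT matrix `F_G^β = P J^β P⁻¹` of order `β`, from `F_G = P J P⁻¹`. -/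
def gfrtMatrix {N : ℕ} {FG : Matrix (Fin N) (Fin N) ℂ} (D : JordanDecomposition FG) (β : ℝ) :
    Matrix (Fin N) (Fin N) ℂ :=
  D.P * Matrix.blockDiagonal' (fun i => jordanBlockPow (D.size i) (D.eigenvalue i) β) * D.Pinv

/-! ### The joint transforms -/

/-- The joint time-vertex Fourier transform `F_G X Fᵀ`. -/
def jft {N T : ℕ} (FG : Matrix (Fin N) (Fin N) ℂ) (X : Matrix (Fin N) (Fin T) ℂ) :
    Matrix (Fin N) (Fin T) ℂ :=
  FG * X * (dftMatrix T)ᵀ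

/-- The joint time-vertex fractional Fourier transform `F_G^β X (F^α)ᵀ` of order `(α, β)`. -/
def jfrt {N T : ℕ} [NeZero T] {FG : Matrix (Fin N) (Fin N) ℂ} (D : JordanDecomposition FG)
    (α β : ℝ) (X : Matrix (Fin N) (Fin T) ℂ) : Matrix (Fin N) (Fin T) ℂ :=
  gfrtMatrix D β * X * (dfrtMatrix T α)ᵀ

end JointFourier

end

/-! For the graph factor, the Jordan block power of exponent 1 is the block itself. The substance is
`dfrtMatrix_one`: the discrete Hermite-Gaussian of index `k`, selected only by parity and by the
order of the eigenvalues of `S`, must have DFT eigenvalue `(-j)^k`.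

The DFT matrix is `C - jK`, with `C` the cosine and `K` the sine matrix. Each commutes with `S` and
is an involution on the signals of its own parity. In half-period coordinates `S` becomes a
tridiagonal matrix `J` with nonnegative off-diagonal and nonzero superdiagonal entries, so its
spectrum on each parity class is simple. Each eigenvector is therefore an eigenvector of `C` (or
`K`) with a sign `ε i`, and everything reduces to `ε i = (-1)^i` (`waveEigenvalue_eq`).

The signs come from a positivity argument on minors (`prod_sign_nonneg`, `sign_eq_neg_one_pow`). On
half a period the transform is `V * diagonal ε * Vᵀ`, with `V` the matrix of eigenvectors. Its
entries are Chebyshev polynomials at decreasing nodes, up to nonnegative column factors, so the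
minors of the first `k` rows have, up to the order of the columns, the sign `∏_{j<k} (-1)^j`. By
Cauchy-Binet these minors expand in the minors of `V`, which are eigenvectors of the `k`-th additive
compound of `J`. A shift of this compound preserves the sign pattern, and iterating it isolates the
`k` largest eigenvalues. The surviving coefficient is `∏_{i<k} ε i` times the square of a nonzero
leading minor. Hence `∏_{i<k} ε i = ∏_{j<k} (-1)^j` for all `k`, and consecutive values of `k` give
each sign. -/

noncomputable section

namespace JointFourier

open Matrix Finset Polynomial

/-! ### Determinants -/

/-- Cauchy-Binet over all tuples instead of increasing ones, which accounts for the factor `k!`.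
Multilinearity in the rows expands the determinant; relabelling the tuple by a permutation produces
two signs that cancel, so all `k!` permutations contribute equally. -/
theorem factorial_mul_det_mul {R ι : Type*} [CommRing R] [Fintype ι] [DecidableEq ι] {k : ℕ}
    (A : Matrix (Fin k) ι R) (B : Matrix ι (Fin k) R) :
    (k.factorial : R) * (A * B).det =
      ∑ f : Fin k → ι, (A.submatrix id f).det * (B.submatrix f id).det := by
  have h1 : (A * B).det = ∑ f : Fin k → ι, (∏ i, A i (f i)) * (B.submatrix f id).det := by
    have e : A * B = fun i => ∑ j, A i j • B j := by
      ext i l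
      simp [Matrix.mul_apply]
    have := (detRowAlternating (R := R) (n := Fin k)).toMultilinearMap.map_sum
      (fun i (j : ι) => A i j • B j)
    rw [e]
    refine this.trans (Finset.sum_congr rfl fun f _ => ?_)
    exact (detRowAlternating (R := R) (n := Fin k)).toMultilinearMap.map_smul_univ _ _
  have h2 : ∀ σ : Equiv.Perm (Fin k), ∑ f : Fin k → ι,
      ((Equiv.Perm.sign σ : ℤ) : R) * (∏ i, A (σ i) (f i)) * (B.submatrix f id).det
      = (A * B).det := by
    intro σ
    rw [h1, ← (Equiv.arrowCongr σ.symm (Equiv.refl ι)).sum_comp]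
    refine Finset.sum_congr rfl fun f _ => ?_
    have e1 : ∏ i, A (σ i) ((Equiv.arrowCongr σ.symm (Equiv.refl ι)) f i) = ∏ i, A i (f i) := by
      rw [← Equiv.prod_comp σ (fun i => A i (f i))]
      simp [Equiv.arrowCongr]
    have e2 : B.submatrix ((Equiv.arrowCongr σ.symm (Equiv.refl ι)) f) id
        = (B.submatrix f id).submatrix σ id := by
      ext i j; simp [Equiv.arrowCongr]
    rw [e1, e2, Matrix.det_permute]
    have : (((Equiv.Perm.sign σ : ℤ) : R)) * ((Equiv.Perm.sign σ : ℤ) : R) = 1 := by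
      rw [← Int.cast_mul, ← Units.val_mul, Int.units_mul_self]; simp
    linear_combination (∏ i, A i (f i)) * (B.submatrix f id).det * this
  simp_rw [Matrix.det_apply' (A.submatrix id _), Finset.sum_mul]
  rw [Finset.sum_comm]
  simp only [Matrix.submatrix_apply, id]
  rw [Finset.sum_congr rfl fun σ _ => h2 σ]
  simp [Fintype.card_perm]

/-- This is the derivative at `t = 0` of `det (M * diagonal (1 + t c))`, computed row by row; the
proof expands along the rows and uses `adjugate M * M = det M`. -/
theorem sum_det_updateRow_mul {R ι : Type*} [CommRing R] [Fintype ι] [DecidableEq ι]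
    (M : Matrix ι ι R) (c : ι → R) :
    ∑ j, (M.updateRow j fun l => c l * M j l).det = (∑ l, c l) * M.det := by
  have h : ∀ j, (M.updateRow j fun l => c l * M j l).det =
      ∑ l, c l * (M.adjugate l j * M j l) := by
    intro j
    rw [← cramer_transpose_apply, cramer_eq_adjugate_mulVec, ← adjugate_transpose]
    simp only [mulVec, dotProduct, transpose_apply]
    exact Finset.sum_congr rfl fun l _ => by ring
  simp_rw [h]
  rw [Finset.sum_comm, Finset.sum_mul]
  refine Finset.sum_congr rfl fun l _ => ?_
  rw [← Finset.mul_sum, ← Matrix.mul_apply, adjugate_mul]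
  simp

theorem det_eval_polynomial {R : Type*} [CommRing R] {k : ℕ} (p : ℕ → R[X])
    (hp : ∀ n, (p n).natDegree = n) (x : Fin k → R) :
    (Matrix.of fun a b : Fin k => (p a).eval (x b)).det =
      (∏ a : Fin k, (p a).leadingCoeff) * (vandermonde x).det := by
  have h := eval_matrixOfPolynomials_eq_vandermonde_mul_matrixOfPolynomials x
    (fun a : Fin k => p a) (fun a => (hp a).le)
  rw [← det_transpose]
  have e : (Matrix.of fun a b : Fin k => (p a).eval (x b))ᵀ =
    Matrix.of fun i j : Fin k => ((p j).eval (x i)) := by ext; rfl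
  rw [e, h, det_mul, mul_comm]
  congr 1
  rw [det_of_isUpperTriangular]
  · refine Finset.prod_congr rfl fun a _ => ?_
    simp [leadingCoeff, hp]
  · intro i j hij
    exact coeff_eq_zero_of_natDegree_lt (by rw [hp]; exact hij)

theorem det_vandermonde_neg {R : Type*} [CommRing R] {k : ℕ} (x : Fin k → R) :
    (vandermonde fun i => -x i).det = (∏ j : Fin k, (-1) ^ (j : ℕ)) * (vandermonde x).det := by
  rw [← det_mul_row]
  congr 1
  ext i j
  simp only [vandermonde_apply, Matrix.of_apply]
  exact neg_pow _ _

/-! ### The additive compound of a matrix -/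

section Compound

variable {k d : ℕ}

/-- `c` plus the `k`-th additive compound of `J`, acting on functions of `k`-tuples. -/
def compoundStep (J : Matrix (Fin d) (Fin d) ℝ) (c : ℝ) (W : (Fin k → Fin d) → ℝ)
    (f : Fin k → Fin d) : ℝ :=
  c * W f + ∑ j, ∑ n, J (f j) n * W (Function.update f j n)

/-- The minors of `V` in the columns `h` are the coordinates of the wedge product of these
eigenvectors, on which the additive compound acts by the sum of the eigenvalues. -/
theorem compoundStep_det {J V : Matrix (Fin d) (Fin d) ℝ} {l : Fin d → ℝ}
    (hJ : J * V = V * diagonal l) (c : ℝ) (h f : Fin k → Fin d) :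
    compoundStep J c (fun f => (V.submatrix f h).det) f =
      (c + ∑ b, l (h b)) * (V.submatrix f h).det := by
  have key : ∀ j, ∑ n, J (f j) n * (V.submatrix (Function.update f j n) h).det =
      ((V.submatrix f h).updateRow j fun b => l (h b) * (V.submatrix f h) j b).det := by
    intro j
    have e : ∀ n, V.submatrix (Function.update f j n) h =
        (V.submatrix f h).updateRow j fun b => V n (h b) := by
      intro n
      ext a b
      by_cases ha : a = j
      · subst ha; simp
      · simp [ha]
    have e2 : (fun b => l (h b) * (V.submatrix f h) j b) =
        ∑ n, J (f j) n • fun b => V n (h b) := by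
      ext b
      have := congrFun (congrFun hJ (f j)) (h b)
      rw [mul_diagonal, mul_apply] at this
      simp only [submatrix_apply, Finset.sum_apply, Pi.smul_apply, smul_eq_mul]
      rw [this, mul_comm]
    rw [e2]
    have := map_sum (cramer (V.submatrix f h)ᵀ) (fun n => J (f j) n • fun b => V n (h b)) univ
    have := congrFun this j
    rw [cramer_transpose_apply] at this
    rw [this, Finset.sum_apply]
    refine Finset.sum_congr rfl fun n _ => ?_
    rw [map_smul, Pi.smul_apply, cramer_transpose_apply, e, smul_eq_mul]
  rw [compoundStep, Finset.sum_congr rfl fun j _ => key j, sum_det_updateRow_mul]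
  ring

theorem compoundStep_sum {ι : Type*} (s : Finset ι) (J : Matrix (Fin d) (Fin d) ℝ) (c : ℝ)
    (a : ι → ℝ) (W : ι → (Fin k → Fin d) → ℝ) (f : Fin k → Fin d) :
    compoundStep J c (fun f => ∑ h ∈ s, a h * W h f) f =
      ∑ h ∈ s, a h * compoundStep J c (W h) f := by
  simp only [compoundStep, mul_add, Finset.mul_sum, Finset.sum_add_distrib]
  congr 1
  · exact Finset.sum_congr rfl fun _ _ => by ring
  · refine Eq.trans ?_ Finset.sum_comm
    refine Finset.sum_congr rfl fun j _ => Eq.trans ?_ Finset.sum_comm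
    exact Finset.sum_congr rfl fun _ _ => Finset.sum_congr rfl fun _ _ => by ring

/-- The Vandermonde determinant of a tuple of indices; its sign is that of the permutation
sorting the tuple, and it vanishes when two entries coincide. -/
def tupleVandermonde (f : Fin k → Fin d) : ℝ :=
  (vandermonde fun i => ((f i : ℕ) : ℝ)).det

theorem tupleVandermonde_eq_zero {f : Fin k → Fin d} (hf : ¬ Function.Injective f) :
    tupleVandermonde f = 0 := by
  rw [tupleVandermonde, ← not_ne_iff, det_vandermonde_ne_zero_iff]
  intro h
  exact hf fun a b hab => h (by simp [hab])

/-- An entry that moves by at most one place without colliding cannot jump over another entry, so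
the relative order of every pair is kept. -/
theorem tupleVandermonde_mul_update_pos {f : Fin k → Fin d} {j : Fin k} {n : Fin d}
    (hf : Function.Injective f) (hf' : Function.Injective (Function.update f j n))
    (h1 : (n : ℕ) ≤ f j + 1) (h2 : (f j : ℕ) ≤ n + 1) :
    0 < tupleVandermonde f * tupleVandermonde (Function.update f j n) := by
  rw [tupleVandermonde, tupleVandermonde, det_vandermonde, det_vandermonde,
    ← Finset.prod_mul_distrib]
  refine Finset.prod_pos fun a _ => ?_
  rw [← Finset.prod_mul_distrib]
  refine Finset.prod_pos fun b hb => ?_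
  have hab : a ≠ b := (Finset.mem_Ioi.mp hb).ne
  have g1 : (f a : ℕ) ≠ f b := fun h => hab (hf (Fin.ext h))
  have g2 : (Function.update f j n a : ℕ) ≠ Function.update f j n b :=
    fun h => hab (hf' (Fin.ext h))
  have key : (0 : ℤ) < (((f b : ℕ) : ℤ) - (f a : ℕ)) *
      (((Function.update f j n b : Fin d) : ℕ) - ((Function.update f j n a : Fin d) : ℕ)) := by
    have : ((f a : ℕ) < f b ∧ (Function.update f j n a : ℕ) < Function.update f j n b) ∨
        ((f b : ℕ) < f a ∧ (Function.update f j n b : ℕ) < Function.update f j n a) := by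
      by_cases ha : a = j
      · have hb : b ≠ j := fun h => hab (ha.trans h.symm)
        subst ha
        simp only [Function.update_self, Function.update_of_ne hb] at g2 ⊢
        omega
      · by_cases hb : b = j
        · subst hb
          simp only [Function.update_self, Function.update_of_ne ha] at g2 ⊢
          omega
        · simp only [Function.update_of_ne ha, Function.update_of_ne hb] at g2 ⊢
          omega
    rcases this with ⟨u, v⟩ | ⟨u, v⟩
    · exact mul_pos (by omega) (by omega)
    · exact mul_pos_of_neg_of_neg (by omega) (by omega)
  exact_mod_cast key

/-- Invariance of the cone of functions that have the sign of `tupleVandermonde`. Tridiagonality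
allows only moves to neighbours, which keep that sign, and these carry nonnegative weights; `hc`
handles the diagonal. -/
theorem compoundStep_mul_nonneg {J : Matrix (Fin d) (Fin d) ℝ} {c : ℝ}
    (hoff : ∀ a b, a ≠ b → 0 ≤ J a b)
    (htri : ∀ a b : Fin d, ((a : ℕ) + 1 < b ∨ (b : ℕ) + 1 < a) → J a b = 0)
    {W : (Fin k → Fin d) → ℝ} (hW : ∀ f, ¬ Function.Injective f → W f = 0)
    (hpos : ∀ f, 0 ≤ W f * tupleVandermonde f)
    (f : Fin k → Fin d) (hc : 0 ≤ c + ∑ j, J (f j) (f j)) :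
    0 ≤ compoundStep J c W f * tupleVandermonde f := by
  by_cases hf : Function.Injective f
  swap
  · simp [tupleVandermonde_eq_zero hf]
  have e : compoundStep J c W f = (c + ∑ j, J (f j) (f j)) * W f +
      ∑ j, ∑ n ∈ univ.erase (f j), J (f j) n * W (Function.update f j n) := by
    rw [compoundStep, add_mul, add_assoc, Finset.sum_mul, ← Finset.sum_add_distrib]
    congr 1
    refine Finset.sum_congr rfl fun j _ => ?_
    rw [← Finset.add_sum_erase _ _ (Finset.mem_univ (f j)), Function.update_eq_self]
  rw [e, add_mul, Finset.sum_mul, mul_assoc]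
  refine add_nonneg (mul_nonneg hc (hpos f)) (Finset.sum_nonneg fun j _ => ?_)
  rw [Finset.sum_mul]
  refine Finset.sum_nonneg fun n hn => ?_
  have hn' : n ≠ f j := Finset.ne_of_mem_erase hn
  by_cases hfar : ((f j : ℕ) + 1 < n ∨ (n : ℕ) + 1 < f j)
  · simp [htri _ _ hfar]
  by_cases hf' : Function.Injective (Function.update f j n)
  swap
  · simp [hW _ hf']
  rw [mul_assoc]
  refine mul_nonneg (hoff _ _ hn'.symm) ?_
  have h1 := tupleVandermonde_mul_update_pos (j := j) (n := n) hf hf' (by omega) (by omega)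
  have h2 := hpos (Function.update f j n)
  -- The product of the negative quantity with the positive `h1` is `W f' * tupleVandermonde f'`,
  -- with `f'` the updated tuple, times a square, hence nonnegative.
  by_contra hneg
  push Not at hneg
  nlinarith [mul_nonneg h2 (sq_nonneg (tupleVandermonde f)),
    mul_neg_of_neg_of_pos hneg h1]

end Compound

/-! ### Eigenvectors of tridiagonal matrices -/

section Tridiagonal

variable {d : ℕ} [NeZero d] {J V : Matrix (Fin d) (Fin d) ℝ} {l : Fin d → ℝ}

/-- Row `n` of the eigenvector equation can be solved for entry `n + 1`, since the superdiagonal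
entry is nonzero; each step multiplies by the eigenvalue once and so raises the degree by one. -/
theorem exists_polynomial_eigenvector
    (hsup : ∀ a b : Fin d, (a : ℕ) + 1 = b → J a b ≠ 0)
    (htri : ∀ a b : Fin d, (a : ℕ) + 1 < b → J a b = 0)
    (hJ : J * V = V * diagonal l) :
    ∃ p : ℕ → ℝ[X], (∀ n, (p n).natDegree = n ∧ p n ≠ 0) ∧
      ∀ n i : Fin d, V n i = (p n).eval (l i) * V 0 i := by
  have main : ∀ n : ℕ, ∃ p : ℝ[X], p.degree = n ∧
      ∀ h : n < d, ∀ i : Fin d, V ⟨n, h⟩ i = p.eval (l i) * V 0 i := by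
    intro n
    induction n using Nat.strong_induction_on with
    | _ n ih =>
    rcases n with _ | n
    · exact ⟨1, by simp, fun h i => by simp⟩
    by_cases hd : n + 1 < d
    swap
    -- Beyond the matrix size any polynomial of the right degree serves.
    · exact ⟨X ^ (n + 1), by simp, fun h => absurd h hd⟩
    choose! q hq1 hq2 using ih
    set a : Fin d := ⟨n, by omega⟩
    set b : Fin d := ⟨n + 1, hd⟩
    have hab : J a b ≠ 0 := hsup a b rfl
    set r : ℝ[X] := X * q n - ∑ m : Fin (n + 1), C (J a ⟨m, by omega⟩) * q m with hr
    have hdeg : r.degree = ((n + 1 : ℕ) : WithBot ℕ) := by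
      have h1 : (X * q n).degree = ((n + 1 : ℕ) : WithBot ℕ) := by
        rw [degree_mul, degree_X, hq1 n (by omega), Nat.cast_add, Nat.cast_one, add_comm]
      rw [hr, degree_sub_eq_left_of_degree_lt, h1]
      rw [h1]
      refine (degree_sum_le _ _).trans_lt ((Finset.sup_lt_iff (WithBot.bot_lt_coe _)).2 ?_)
      intro m _
      rw [← smul_eq_C_mul]
      refine (degree_smul_le _ _).trans_lt ?_
      rw [hq1 m (by omega)]
      exact_mod_cast m.2
    refine ⟨C (J a b)⁻¹ * r, ?_, fun h i => ?_⟩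
    · rw [degree_C_mul (inv_ne_zero hab), hdeg]
    have e := congrFun (congrFun hJ a) i
    rw [mul_diagonal, mul_apply] at e
    have e2 : ∑ m, J a m * V m i =
        ∑ m : Fin (n + 1), J a ⟨m, by omega⟩ * V ⟨m, by omega⟩ i + J a b * V b i := by
      have e3 : ∀ m : Fin d, m ∉ univ.map (Fin.castLEEmb (Nat.succ_le_of_lt hd)) →
          J a m * V m i = 0 := by
        intro m hm
        rw [htri a m, zero_mul]
        by_contra hlt
        refine hm (Finset.mem_map.2 ⟨⟨m, ?_⟩, Finset.mem_univ _, rfl⟩)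
        simp only [a] at hlt
        omega
      rw [← Finset.sum_subset (Finset.subset_univ _) fun m _ hm => e3 m hm, Finset.sum_map,
        Fin.sum_univ_castSucc]
      rfl
    rw [e2] at e
    have e4 : V b i = (J a b)⁻¹ * (V a i * l i -
        ∑ m : Fin (n + 1), J a ⟨m, by omega⟩ * V ⟨m, by omega⟩ i) := by
      rw [eq_inv_mul_iff_mul_eq₀ hab]
      linarith
    rw [e4, eval_mul, eval_C, hr, eval_sub, eval_mul, eval_X, eval_finsetSum,
      hq2 n (by omega) (by omega), mul_assoc (J a b)⁻¹, sub_mul, Finset.sum_mul]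
    congr 2
    · ring
    · refine Finset.sum_congr rfl fun m _ => ?_
      rw [hq2 m (by omega), eval_mul, eval_C, mul_assoc]
  choose p hp1 hp2 using main
  exact ⟨p, fun n => ⟨natDegree_eq_of_degree_eq_some (hp1 n),
    fun h => by have := hp1 n; simp [h] at this⟩, fun n i => hp2 n n.2 i⟩

theorem eigenvector_zero_ne_zero
    (hsup : ∀ a b : Fin d, (a : ℕ) + 1 = b → J a b ≠ 0)
    (htri : ∀ a b : Fin d, (a : ℕ) + 1 < b → J a b = 0)
    (hJ : J * V = V * diagonal l) (hV : V.det ≠ 0) (i : Fin d) : V 0 i ≠ 0 := by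
  obtain ⟨p, -, hp⟩ := exists_polynomial_eigenvector hsup htri hJ
  intro h
  exact hV (det_eq_zero_of_column_eq_zero i fun n => by rw [hp, h, mul_zero])

theorem eigenvalue_injective
    (hsup : ∀ a b : Fin d, (a : ℕ) + 1 = b → J a b ≠ 0)
    (htri : ∀ a b : Fin d, (a : ℕ) + 1 < b → J a b = 0)
    (hJ : J * V = V * diagonal l) (hV : V.det ≠ 0) : Function.Injective l := by
  obtain ⟨p, -, hp⟩ := exists_polynomial_eigenvector hsup htri hJ
  intro i j hij
  by_contra hne
  -- Columns with equal eigenvalues are proportional to their first entries, so this combination of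
  -- the two vanishes.
  refine hV (exists_mulVec_eq_zero_iff.1 ⟨Pi.single i (V 0 j) - Pi.single j (V 0 i), ?_, ?_⟩)
  · intro h
    have := congrFun h i
    simp [hne] at this
    exact eigenvector_zero_ne_zero hsup htri hJ hV j this
  · ext n
    rw [mulVec_sub, mulVec_single, mulVec_single]
    simp only [Pi.sub_apply, Pi.smul_apply, col_apply, Pi.zero_apply, MulOpposite.smul_eq_mul_unop,
      MulOpposite.unop_op]
    rw [hp n i, hp n j, hij]
    ring

/-- Up to the nonzero first entries and leading coefficients, the leading minor is the Vandermonde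
determinant of distinct eigenvalues. -/
theorem det_submatrix_castLE_ne_zero
    (hsup : ∀ a b : Fin d, (a : ℕ) + 1 = b → J a b ≠ 0)
    (htri : ∀ a b : Fin d, (a : ℕ) + 1 < b → J a b = 0)
    (hJ : J * V = V * diagonal l) (hV : V.det ≠ 0) {k : ℕ} (hk : k ≤ d) :
    (V.submatrix (Fin.castLE hk) (Fin.castLE hk)).det ≠ 0 := by
  obtain ⟨p, hp, hpV⟩ := exists_polynomial_eigenvector hsup htri hJ
  have e : V.submatrix (Fin.castLE hk) (Fin.castLE hk) =
      Matrix.of fun a b : Fin k => V 0 (Fin.castLE hk b) *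
        (Matrix.of fun a b : Fin k => (p a).eval (l (Fin.castLE hk b))) a b := by
    ext a b
    simp only [submatrix_apply, Matrix.of_apply]
    rw [hpV, mul_comm]
    rfl
  rw [e, det_mul_row, det_eval_polynomial p (fun n => (hp n).1)]
  refine mul_ne_zero (Finset.prod_ne_zero_iff.2 fun b _ =>
    eigenvector_zero_ne_zero hsup htri hJ hV _) (mul_ne_zero (Finset.prod_ne_zero_iff.2 fun a _ =>
    leadingCoeff_ne_zero.2 (hp a).2) (det_vandermonde_ne_zero_iff.2 fun a b hab => ?_))
  simpa using eigenvalue_injective hsup htri hJ hV hab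

end Tridiagonal

/-! ### Sums of eigenvalues -/

theorem image_eq_or_sum_lt {k d : ℕ} (hk : k ≤ d) {l : Fin d → ℝ} (hl : StrictAnti l)
    {h : Fin k → Fin d} (hh : Function.Injective h) :
    univ.image h = univ.image (Fin.castLE hk) ∨ ∑ b, l (h b) < ∑ b, l (Fin.castLE hk b) := by
  rw [or_iff_not_imp_left]
  intro hne
  have hc : Function.Injective (Fin.castLE hk) := Fin.castLE_injective hk
  rcases k with _ | k
  · exact absurd (by simp) hne
  set R := univ.image (Fin.castLE hk) with hR
  set S := univ.image h with hS
  -- Subtracting the smallest of the leading eigenvalues makes the terms nonnegative on `R` and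
  -- negative off it; both sums have the same number of terms, so the shift cancels.
  set t := l (Fin.castLE hk (Fin.last k)) with ht
  have hmem : ∀ x : Fin d, x ∈ R ↔ (x : ℕ) ≤ k := by
    intro x
    simp only [hR, Finset.mem_image, Finset.mem_univ, true_and]
    constructor
    · rintro ⟨a, rfl⟩
      simp; omega
    · intro hx
      exact ⟨⟨x, by omega⟩, rfl⟩
  have hcard : S.card = R.card := by
    rw [hS, hR, Finset.card_image_of_injective _ hh, Finset.card_image_of_injective _ hc]
  have hout : ∀ x, x ∉ R → l x - t < 0 := by
    intro x hx
    rw [hmem] at hx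
    have : l x < t := hl (Fin.lt_def.2 (by simp; omega))
    linarith
  have hin : ∀ x, x ∈ R → 0 ≤ l x - t := by
    intro x hx
    rw [hmem] at hx
    have : t ≤ l x := hl.antitone (Fin.le_def.2 (by simp; omega))
    linarith
  obtain ⟨y, hyS, hyR⟩ : ∃ y ∈ S, y ∉ R := by
    by_contra hcon
    push Not at hcon
    exact hne (Finset.eq_of_subset_of_card_le hcon hcard.ge)
  have e1 : ∑ b, (l (h b) - t) = ∑ x ∈ S, (l x - t) := by
    rw [hS, Finset.sum_image hh.injOn]
  have e2 : ∑ b, (l (Fin.castLE hk b) - t) = ∑ x ∈ R, (l x - t) := by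
    rw [hR, Finset.sum_image hc.injOn]
  have h1 : ∑ x ∈ S, (l x - t) < ∑ x ∈ S ∩ R, (l x - t) := by
    rw [← Finset.sum_inter_add_sum_sdiff S R]
    have : ∑ x ∈ S \ R, (l x - t) < 0 :=
      Finset.sum_neg (fun x hx => hout x (Finset.mem_sdiff.1 hx).2)
        ⟨y, Finset.mem_sdiff.2 ⟨hyS, hyR⟩⟩
    linarith
  have h2 : ∑ x ∈ S ∩ R, (l x - t) ≤ ∑ x ∈ R, (l x - t) :=
    Finset.sum_le_sum_of_subset_of_nonneg Finset.inter_subset_right fun x hx _ => hin x hx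
  have h3 := h1.trans_le h2
  rw [← e1, ← e2, Finset.sum_sub_distrib, Finset.sum_sub_distrib] at h3
  linarith

/-- Power iteration: after division by `r i₀ ^ N` only the terms with `r i = r i₀` survive in the
limit. Ties must be admitted because permutations of one tuple of eigenvalues have the same sum. -/
theorem nonneg_of_sum_pow_mul_nonneg {ι : Type*} (s : Finset ι) {r b : ι → ℝ} {i₀ : ι}
    (hi₀ : i₀ ∈ s) (hr₀ : 0 < r i₀) (hr : ∀ i ∈ s, 0 ≤ r i)
    (hdom : ∀ i ∈ s, b i = 0 ∨ r i < r i₀ ∨ (r i = r i₀ ∧ (0 ≤ b i ↔ 0 ≤ b i₀)))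
    (hsum : ∀ N : ℕ, 0 ≤ ∑ i ∈ s, r i ^ N * b i) : 0 ≤ b i₀ := by
  by_contra hneg
  have hlim : Filter.Tendsto (fun N : ℕ => ∑ i ∈ s, (r i / r i₀) ^ N * b i) Filter.atTop
      (nhds (∑ i ∈ s, if r i = r i₀ then b i else 0)) := by
    refine tendsto_finsetSum _ fun i hi => ?_
    rcases hdom i hi with h | h | ⟨h, -⟩
    · simp [h]
    · rw [if_neg h.ne]
      have := (tendsto_pow_atTop_nhds_zero_of_lt_one (div_nonneg (hr i hi) hr₀.le)
        ((div_lt_one hr₀).2 h)).mul_const (b i)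
      simpa using this
    · simp [h, hr₀.ne']
  have h0 : 0 ≤ ∑ i ∈ s, if r i = r i₀ then b i else 0 := by
    refine ge_of_tendsto' hlim fun N => ?_
    have := div_nonneg (hsum N) (pow_pos hr₀ N).le
    rw [Finset.sum_div] at this
    convert this using 2 with i _
    rw [div_pow]; ring
  have h1 : ∑ i ∈ s, (if r i = r i₀ then b i else 0) < 0 := by
    refine Finset.sum_neg' (fun i hi => ?_) ⟨i₀, hi₀, by simpa using hneg⟩
    split_ifs with h
    · rcases hdom i hi with h' | h' | ⟨-, h'⟩
      · exact h'.le
      · exact absurd h h'.ne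
      · exact le_of_not_ge (mt h'.1 hneg)
    · exact le_rfl
  linarith

/-! ### Alternation of signs along the spectrum of a tridiagonal matrix -/

section Alternation

variable {d : ℕ} {J V : Matrix (Fin d) (Fin d) ℝ} {l ε : Fin d → ℝ}

/-- Each application of the shifted compound keeps the cone and multiplies the coefficient of the
minor `h` by its eigenvalue. -/
theorem compound_iterate_nonneg {k : ℕ}
    (hoff : ∀ a b, a ≠ b → 0 ≤ J a b)
    (htri : ∀ a b : Fin d, ((a : ℕ) + 1 < b ∨ (b : ℕ) + 1 < a) → J a b = 0)
    (hJ : J * V = V * diagonal l) {c : ℝ}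
    (hc : ∀ f : Fin k → Fin d, 0 ≤ c + ∑ j, J (f j) (f j)) (a : (Fin k → Fin d) → ℝ)
    (h0 : ∀ f, 0 ≤ (∑ h, a h * (V.submatrix f h).det) * tupleVandermonde f) (N : ℕ)
    (f : Fin k → Fin d) :
    0 ≤ (∑ h, ((c + ∑ b, l (h b)) ^ N * a h) * (V.submatrix f h).det) * tupleVandermonde f := by
  induction N generalizing f with
  | zero => simpa using h0 f
  | succ N ih =>
    have hz : ∀ f : Fin k → Fin d, ¬ Function.Injective f →
        ∑ h, ((c + ∑ b, l (h b)) ^ N * a h) * (V.submatrix f h).det = 0 := by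
      intro f hf
      refine Finset.sum_eq_zero fun h _ => ?_
      simp only [Function.Injective, not_forall] at hf
      obtain ⟨i, j, hij, hne⟩ := hf
      rw [det_zero_of_row_eq hne (by ext b; simp [hij]), mul_zero]
    have := compoundStep_mul_nonneg hoff htri hz ih f (hc f)
    rw [compoundStep_sum univ J c _ (fun h f => (V.submatrix f h).det)] at this
    convert this using 3 with h _
    rw [compoundStep_det hJ]
    ring

/-- The product of the first `k` of the signs `ε`, when the matrix `V * diagonal ε * Vᵀ` has
minors of constant sign in its first `k` rows. -/
theorem prod_sign_nonneg [NeZero d] {k : ℕ} (hk : k ≤ d)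
    (hoff : ∀ a b, a ≠ b → 0 ≤ J a b)
    (hsup : ∀ a b : Fin d, (a : ℕ) + 1 = b → J a b ≠ 0)
    (htri : ∀ a b : Fin d, ((a : ℕ) + 1 < b ∨ (b : ℕ) + 1 < a) → J a b = 0)
    (hJ : J * V = V * diagonal l) (hV : V.det ≠ 0) (hl : Antitone l) (s : ℝ)
    (hs : ∀ f : Fin k → Fin d, 0 ≤
      s * ((V * diagonal ε * Vᵀ).submatrix (Fin.castLE hk) f).det * tupleVandermonde f) :
    0 ≤ s * ∏ i, ε (Fin.castLE hk i) := by
  have htri' : ∀ a b : Fin d, (a : ℕ) + 1 < b → J a b = 0 := fun a b h => htri a b (.inl h)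
  have hl' : StrictAnti l :=
    hl.strictAnti_of_injective (eigenvalue_injective hsup htri' hJ hV)
  set top : Fin k → Fin d := Fin.castLE hk with htop
  have hD := det_submatrix_castLE_ne_zero hsup htri' hJ hV hk
  rw [← htop] at hD
  obtain ⟨c, hc⟩ : ∃ c : ℝ, ∀ f : Fin k → Fin d,
      0 ≤ c + ∑ j, J (f j) (f j) ∧ 0 < c + ∑ b, l (f b) := by
    -- A crude bound: the sum over all tuples dominates each of its terms.
    refine ⟨∑ f : Fin k → Fin d, (|∑ j, J (f j) (f j)| + |∑ b, l (f b)| + 1), fun f => ?_⟩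
    have := Finset.single_le_sum (f := fun f : Fin k → Fin d =>
      (|∑ j, J (f j) (f j)| + |∑ b, l (f b)| + 1)) (fun f _ => by positivity) (Finset.mem_univ f)
    constructor
    · linarith [neg_abs_le (∑ j, J (f j) (f j)), abs_nonneg (∑ b, l (f b))]
    · linarith [neg_abs_le (∑ b, l (f b)), abs_nonneg (∑ j, J (f j) (f j))]
  set a : (Fin k → Fin d) → ℝ := fun h => s * (∏ i, ε (h i)) * (V.submatrix top h).det with ha
  have expand : ∀ f : Fin k → Fin d, ∑ h, a h * (V.submatrix f h).det =
      k.factorial * (s * ((V * diagonal ε * Vᵀ).submatrix top f).det) := by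
    intro f
    have e : (V * diagonal ε * Vᵀ).submatrix top f =
        (V * diagonal ε).submatrix top id * Vᵀ.submatrix id f := by
      rw [submatrix_mul _ _ _ id _ Function.bijective_id]
    rw [mul_left_comm, e, factorial_mul_det_mul, Finset.mul_sum]
    refine Finset.sum_congr rfl fun h _ => ?_
    have e1 : ((V * diagonal ε).submatrix top id).submatrix id h =
        Matrix.of fun i j => ε (h j) * (V.submatrix top h) i j := by
      ext i j; simp [mul_diagonal, mul_comm]
    have e2 : (Vᵀ.submatrix id f).submatrix h id = (V.submatrix f h)ᵀ := by
      ext i j; rfl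
    rw [e1, e2, det_mul_row, det_transpose, ha]
    ring
  have hnn := compound_iterate_nonneg hoff htri hJ (fun f => (hc f).1) a (fun f => by
    rw [expand, mul_assoc]
    exact mul_nonneg (by positivity) (hs f))
  have hvand : 0 < tupleVandermonde top := by
    rw [tupleVandermonde, det_vandermonde]
    refine Finset.prod_pos fun i _ => Finset.prod_pos fun j hj => ?_
    have : i < j := Finset.mem_Ioi.mp hj
    simpa [htop] using this
  have key : 0 ≤ a top * (V.submatrix top top).det := by
    refine nonneg_of_sum_pow_mul_nonneg univ
      (r := fun h => c + ∑ b, l (h b)) (b := fun h => a h * (V.submatrix top h).det)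
      (Finset.mem_univ top) (hc top).2 (fun h _ => (hc h).2.le) (fun h _ => ?_) (fun N => ?_)
    · by_cases hh : Function.Injective h
      swap
      · left
        simp only [Function.Injective, not_forall] at hh
        obtain ⟨i, j, hij, hne⟩ := hh
        rw [det_zero_of_column_eq hne (fun b => by simp [hij]), mul_zero]
      rcases image_eq_or_sum_lt hk hl' hh with h1 | h1
      swap
      · exact .inr (.inl (by simpa using h1))
      have htinj : Function.Injective top := Fin.castLE_injective hk
      have hsum : ∑ b, l (h b) = ∑ b, l (top b) := by
        rw [← Finset.sum_image (f := l) hh.injOn, h1, Finset.sum_image htinj.injOn]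
      have hprod : ∏ b, ε (h b) = ∏ b, ε (top b) := by
        rw [← Finset.prod_image (f := ε) hh.injOn, h1, Finset.prod_image htinj.injOn]
      by_cases hdet : (V.submatrix top h).det = 0
      · left; rw [hdet, mul_zero]
      refine .inr (.inr ⟨by rw [hsum], ?_⟩)
      -- Both coefficients are `s * ∏ ε` times a nonzero square, with the same product of signs.
      simp only [ha, hprod, mul_assoc _ (Matrix.det _) (Matrix.det _)]
      rw [mul_nonneg_iff_of_pos_right (mul_self_pos.2 hdet),
        mul_nonneg_iff_of_pos_right (mul_self_pos.2 hD)]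
    · have := nonneg_of_mul_nonneg_left (hnn N top) hvand
      simpa only [mul_assoc] using this
  simp only [ha, mul_assoc _ (Matrix.det _) (Matrix.det _)] at key
  rwa [mul_nonneg_iff_of_pos_right (mul_self_pos.2 hD)] at key

theorem sign_eq_neg_one_pow
    (hoff : ∀ a b, a ≠ b → 0 ≤ J a b)
    (hsup : ∀ a b : Fin d, (a : ℕ) + 1 = b → J a b ≠ 0)
    (htri : ∀ a b : Fin d, ((a : ℕ) + 1 < b ∨ (b : ℕ) + 1 < a) → J a b = 0)
    (hJ : J * V = V * diagonal l) (hV : V.det ≠ 0) (hl : Antitone l)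
    (hε : ∀ i, ε i * ε i = 1) (p : ℕ → ℝ[X]) (hp : ∀ n, (p n).natDegree = n)
    (hp' : ∀ n, 0 < (p n).leadingCoeff) {x g : Fin d → ℝ} (hx : StrictAnti x)
    (hg : ∀ i, 0 ≤ g i)
    (hC : ∀ m n, (V * diagonal ε * Vᵀ) m n = g n * (p m).eval (x n)) (i : Fin d) :
    ε i = (-1) ^ (i : ℕ) := by
  have : NeZero d := ⟨by have := i.2; omega⟩
  have hprod : ∀ k (hk : k ≤ d), ∏ i, ε (Fin.castLE hk i) = ∏ j : Fin k, (-1) ^ (j : ℕ) := by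
    intro k hk
    have h0 : 0 ≤ (∏ j : Fin k, (-1 : ℝ) ^ (j : ℕ)) * ∏ i, ε (Fin.castLE hk i) := by
      refine prod_sign_nonneg hk hoff hsup htri hJ hV hl _ fun f => ?_
      have e : (V * diagonal ε * Vᵀ).submatrix (Fin.castLE hk) f = Matrix.of fun a b : Fin k =>
          g (f b) * (Matrix.of fun a b : Fin k => (p a).eval (x (f b))) a b := by
        ext a b
        simp [hC]
      rw [e, det_mul_row, det_eval_polynomial p hp]
      -- The nodes decrease, so their negatives are ordered like the indices; the change of sign of
      -- the nodes produces the factor `∏ (-1)^j`.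
      have h1 : 0 ≤ (vandermonde fun i => -x (f i)).det * tupleVandermonde f := by
        rw [tupleVandermonde, det_vandermonde, det_vandermonde, ← Finset.prod_mul_distrib]
        refine Finset.prod_nonneg fun a _ => ?_
        rw [← Finset.prod_mul_distrib]
        refine Finset.prod_nonneg fun b _ => ?_
        rcases le_total (f a) (f b) with h | h
        · exact mul_nonneg (by linarith [hx.antitone h]) (by
            simpa using (show (f a : ℕ) ≤ f b from h))
        · exact mul_nonneg_of_nonpos_of_nonpos (by linarith [hx.antitone h]) (by
            simpa using (show (f b : ℕ) ≤ f a from h))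
      rw [det_vandermonde_neg] at h1
      have h2 := mul_nonneg (mul_nonneg (Finset.prod_nonneg fun b (_ : b ∈ univ) => hg (f b))
        (Finset.prod_nonneg fun (a : Fin k) (_ : a ∈ univ) => (hp' a).le)) h1
      exact h2.trans_eq (by ring)
    have h1 : (∏ i, ε (Fin.castLE hk i)) * (∏ i, ε (Fin.castLE hk i)) = 1 := by
      rw [← Finset.prod_mul_distrib]
      exact Finset.prod_eq_one fun i _ => hε _
    have h2 : (∏ j : Fin k, (-1 : ℝ) ^ (j : ℕ)) * (∏ j : Fin k, (-1 : ℝ) ^ (j : ℕ)) = 1 := by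
      rw [← Finset.prod_mul_distrib]
      exact Finset.prod_eq_one fun i _ => by rw [← mul_pow]; simp
    rcases mul_self_eq_one_iff.1 h1 with a | a <;> rcases mul_self_eq_one_iff.1 h2 with b | b <;>
      rw [a, b] at h0 ⊢ <;> norm_num at h0
  have h1 := hprod (i + 1) i.2
  have h2 := hprod i i.2.le
  rw [Fin.prod_univ_castSucc, Fin.prod_univ_castSucc] at h1
  have h3 : ∏ j : Fin (i : ℕ), ε (Fin.castLE i.2.le j) ≠ 0 :=
    Finset.prod_ne_zero_iff.2 fun j _ h => by simpa [h] using hε (Fin.castLE i.2.le j)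
  simp only [Fin.val_castSucc, Fin.val_last] at h1
  rw [← h2] at h1
  exact mul_left_cancel₀ h3 h1

end Alternation

/-! ### Signals of given parity and their values on half a period -/

theorem val_add_one_mod {T : ℕ} [NeZero T] (n : Fin T) :
    ((n + 1 : Fin T) : ℕ) = if (n : ℕ) + 1 = T then 0 else (n : ℕ) + 1 := by
  have := n.2
  rw [Fin.val_add, Fin.val_one', Nat.add_mod_mod]
  split_ifs with h
  · simp [h]
  · exact Nat.mod_eq_of_lt (by omega)

theorem val_sub_one_mod {T : ℕ} [NeZero T] (n : Fin T) :
    ((n - 1 : Fin T) : ℕ) = if (n : ℕ) = 0 then T - 1 else (n : ℕ) - 1 := by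
  have h1 := n.2
  have h2 := (n - 1).2
  have h3 := val_add_one_mod (n - 1)
  rw [sub_add_cancel] at h3
  split_ifs at h3 ⊢ <;> omega

theorem val_neg_mod {T : ℕ} [NeZero T] (n : Fin T) :
    ((-n : Fin T) : ℕ) = if (n : ℕ) = 0 then 0 else T - (n : ℕ) := by
  rw [Fin.val_neg]
  simp only [Fin.ext_iff, Fin.val_zero]

/-- The dimension of the space of even (`p = 0`) or odd (`p = 1`) signals. -/
def parityDim (T p : ℕ) : ℕ := (T - p) / 2 + 1 - p

/-- The indices `p, p + 1, …` of half a period, which determine a signal of parity `p`. -/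
def halfIndex {T p : ℕ} [NeZero T] (hp : p ≤ 1) (i : Fin (parityDim T p)) : Fin T :=
  ⟨i + p, by
    have h1 := i.2
    have h2 : T ≠ 0 := NeZero.ne T
    unfold parityDim at h1
    omega⟩

/-- The signal of parity `p` with given values on half a period. -/
def parityExtend {T p : ℕ} (y : Fin (parityDim T p) → ℝ) : EuclideanSpace ℝ (Fin T) :=
  WithLp.toLp 2 fun n =>
    if h : p ≤ (n : ℕ) ∧ (n : ℕ) - p < parityDim T p then y ⟨(n : ℕ) - p, h.2⟩
    else if h : T - (n : ℕ) - p < parityDim T p then (-1) ^ p * y ⟨T - (n : ℕ) - p, h⟩ else 0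

section

variable {T p : ℕ}

theorem parityExtend_single (hp : p ≤ 1) (j : Fin (parityDim T p)) (n : Fin T) :
    parityExtend (Pi.single j 1) n =
      if (n : ℕ) = j + p then 1 else if (n : ℕ) + j + p = T then (-1 : ℝ) ^ p else 0 := by
  have hj := j.2
  have hn := n.2
  simp only [parityExtend, Pi.single_apply, Fin.ext_iff]
  unfold parityDim at *
  split_ifs <;> first | omega | simp

theorem parityExtend_single_nonneg (hp : p ≤ 1) (j : Fin (parityDim T p)) {n : Fin T}
    (hn : p = 0 ∨ (n : ℕ) + j + p ≠ T) : 0 ≤ parityExtend (Pi.single j 1) n := by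
  rw [parityExtend_single hp]
  split_ifs with h1 h2
  · exact zero_le_one
  · rw [hn.resolve_right (not_not.2 h2), pow_zero]
    exact zero_le_one
  · exact le_rfl

variable [NeZero T]

theorem parityExtend_mem (hp : p ≤ 1) (y : Fin (parityDim T p) → ℝ) :
    parityExtend y ∈ paritySpace T p := by
  intro n
  have hn := n.2
  have hT : T ≠ 0 := NeZero.ne T
  simp only [parityExtend, val_neg_mod]
  by_cases h0 : (n : ℕ) = 0
  · have : p = 0 ∨ p = 1 := by omega
    rcases this with rfl | rfl
    · simp [h0]
    · have h1 : ¬ (T - 0 - 1 < parityDim T 1) := by unfold parityDim; omega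
      rw [Nat.sub_zero] at h1
      simp [h0, h1]
  simp only [h0, if_false]
  have : p = 0 ∨ p = 1 := by omega
  rcases this with rfl | rfl
  · have e : T - (T - (n : ℕ)) = n := by omega
    simp only [Nat.sub_zero, e, zero_le, true_and, pow_zero, one_mul]
    by_cases h1 : (n : ℕ) < parityDim T 0 <;> by_cases h2 : T - (n : ℕ) < parityDim T 0
    · simp only [h1, h2, dif_pos]
      congr 2
      unfold parityDim at h1 h2
      omega
    · simp [h1, h2]
    · simp [h1, h2]
    · simp [h1, h2]
  · have e : T - (T - (n : ℕ)) = n := by omega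
    have g1 : 1 ≤ (n : ℕ) := by omega
    have g2 : 1 ≤ T - (n : ℕ) := by omega
    simp only [e, g1, g2, true_and, pow_one]
    by_cases h1 : (n : ℕ) - 1 < parityDim T 1 <;> by_cases h2 : T - (n : ℕ) - 1 < parityDim T 1
    · exfalso
      unfold parityDim at h1 h2
      omega
    · simp [h1, h2]
    · simp [h1, h2]
    · simp [h1, h2]

theorem parityExtend_halfIndex (hp : p ≤ 1) (y : Fin (parityDim T p) → ℝ)
    (i : Fin (parityDim T p)) : parityExtend y (halfIndex hp i) = y i := by
  have h : p ≤ ((halfIndex hp i : Fin T) : ℕ) ∧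
      ((halfIndex hp i : Fin T) : ℕ) - p < parityDim T p := by
    simp [halfIndex]
  simp only [parityExtend]
  rw [dif_pos h]
  congr 1
  simp [halfIndex]

theorem parityExtend_comp_halfIndex (hp : p ≤ 1) {x : EuclideanSpace ℝ (Fin T)}
    (hx : x ∈ paritySpace T p) : parityExtend (fun i => x (halfIndex hp i)) = x := by
  ext n
  have hn := n.2
  have hxn : x (-n) = (-1) ^ p * x n := hx n
  simp only [parityExtend]
  split_ifs with h1 h2
  · refine congrArg x.ofLp (Fin.ext ?_)
    simp only [halfIndex]
    omega
  · have h0 : (n : ℕ) ≠ 0 := by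
      intro h0
      unfold parityDim at h1 h2
      omega
    have e : halfIndex hp ⟨T - (n : ℕ) - p, h2⟩ = -n := by
      rw [Fin.ext_iff, val_neg_mod, if_neg h0]
      simp only [halfIndex]
      unfold parityDim at h2
      omega
    rw [e, hxn, ← mul_assoc, ← mul_pow]
    simp
  -- The indices left over are the fixed points of negation, where an odd signal vanishes.
  · have e : -n = n ∧ p = 1 := by
      rw [Fin.ext_iff, val_neg_mod]
      unfold parityDim at h1 h2
      split_ifs <;> omega
    rw [e.1, e.2] at hxn
    linarith

/-- Restriction to half a period, as an equivalence. -/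
def halfEquiv (hp : p ≤ 1) : paritySpace T p ≃ₗ[ℝ] (Fin (parityDim T p) → ℝ) where
  toFun x i := (x : EuclideanSpace ℝ (Fin T)) (halfIndex hp i)
  map_add' _ _ := rfl
  map_smul' _ _ := rfl
  invFun y := ⟨parityExtend y, parityExtend_mem hp y⟩
  left_inv x := Subtype.ext (parityExtend_comp_halfIndex hp x.2)
  right_inv y := funext (parityExtend_halfIndex hp y)

theorem finrank_paritySpace (hp : p ≤ 1) :
    Module.finrank ℝ (paritySpace T p) = parityDim T p := by
  rw [(halfEquiv hp).finrank_eq]; simp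

/-- The operator `S` on the signals of parity `p`, as a tridiagonal matrix. -/
def halfHermite (T : ℕ) [NeZero T] {p : ℕ} (hp : p ≤ 1) :
    Matrix (Fin (parityDim T p)) (Fin (parityDim T p)) ℝ :=
  LinearMap.toMatrix'
    ((halfEquiv hp).toLinearMap ∘ₗ hermiteOpParity T p ∘ₗ (halfEquiv hp).symm.toLinearMap)

theorem halfHermite_mulVec (hp : p ≤ 1) (x : paritySpace T p) :
    halfHermite T hp *ᵥ halfEquiv hp x = halfEquiv hp (hermiteOpParity T p x) := by
  rw [halfHermite, LinearMap.toMatrix'_mulVec]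
  simp

theorem halfHermite_apply (hp : p ≤ 1) (i j : Fin (parityDim T p)) :
    halfHermite T hp i j =
      parityExtend (Pi.single j 1) (halfIndex hp i + 1 : Fin T) +
      parityExtend (Pi.single j 1) (halfIndex hp i - 1 : Fin T) +
      (2 * Real.cos (2 * Real.pi * ((halfIndex hp i : Fin T) : ℕ) / T) - 4) *
        (Pi.single j 1 : Fin (parityDim T p) → ℝ) i := by
  rw [halfHermite, LinearMap.toMatrix'_apply, ← parityExtend_halfIndex (T := T) hp (Pi.single j 1) i,
    ← hermiteOp_apply]
  rfl

theorem val_halfIndex_add_one (hp : p ≤ 1) (i : Fin (parityDim T p)) :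
    ((i : ℕ) + p + 1 = T ∧ ((halfIndex hp i + 1 : Fin T) : ℕ) = 0) ∨
      ((i : ℕ) + p + 1 < T ∧ ((halfIndex hp i + 1 : Fin T) : ℕ) = i + p + 1) := by
  have h := (halfIndex hp i : Fin T).2
  have e : ((halfIndex hp i : Fin T) : ℕ) = i + p := rfl
  rw [val_add_one_mod, e]
  split_ifs <;> omega

theorem val_halfIndex_sub_one (hp : p ≤ 1) (i : Fin (parityDim T p)) :
    ((i : ℕ) + p = 0 ∧ ((halfIndex hp i - 1 : Fin T) : ℕ) = T - 1) ∨
      (0 < (i : ℕ) + p ∧ ((halfIndex hp i - 1 : Fin T) : ℕ) = i + p - 1) := by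
  have e : ((halfIndex hp i : Fin T) : ℕ) = i + p := rfl
  rw [val_sub_one_mod, e]
  split_ifs <;> omega

/-- For odd signals a reflected neighbour enters with sign `-1`, but it reflects onto the index
itself, so the negative term lies on the diagonal and `i ≠ j` excludes it. -/
theorem parityExtend_single_add_one_nonneg (hp : p ≤ 1) {i j : Fin (parityDim T p)}
    (hij : i ≠ j) : 0 ≤ parityExtend (Pi.single j 1) (halfIndex hp i + 1 : Fin T) := by
  have hi := i.2
  have hj := j.2
  have hij' : (i : ℕ) ≠ j := fun h => hij (Fin.ext h)
  have hv := val_halfIndex_add_one (T := T) hp i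
  refine parityExtend_single_nonneg hp j ?_
  generalize ((halfIndex hp i + 1 : Fin T) : ℕ) = v at hv ⊢
  unfold parityDim at hi hj
  omega

theorem parityExtend_single_sub_one_nonneg (hp : p ≤ 1) (i j : Fin (parityDim T p)) :
    0 ≤ parityExtend (Pi.single j 1) (halfIndex hp i - 1 : Fin T) := by
  have hi := i.2
  have hj := j.2
  have hv := val_halfIndex_sub_one (T := T) hp i
  refine parityExtend_single_nonneg hp j ?_
  generalize ((halfIndex hp i - 1 : Fin T) : ℕ) = v at hv ⊢
  unfold parityDim at hi hj
  omega

theorem halfHermite_nonneg (hp : p ≤ 1) (i j : Fin (parityDim T p)) (hij : i ≠ j) :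
    0 ≤ halfHermite T hp i j := by
  rw [halfHermite_apply, Pi.single_eq_of_ne hij, mul_zero, add_zero]
  exact add_nonneg (parityExtend_single_add_one_nonneg hp hij)
    (parityExtend_single_sub_one_nonneg hp i j)

/-- The right neighbour contributes 1 and the left one cannot cancel it. For even signals both
neighbours of 0 fold onto the index 1, so the entry there is 2 and the matrix need not be symmetric.
-/
theorem halfHermite_ne_zero (hp : p ≤ 1) (i j : Fin (parityDim T p)) (hij : (i : ℕ) + 1 = j) :
    halfHermite T hp i j ≠ 0 := by
  have hne : i ≠ j := fun h => by rw [h] at hij; omega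
  have hj : (j : ℕ) + p < T := (halfIndex hp j : Fin T).2
  have h1 : parityExtend (Pi.single j 1) (halfIndex hp i + 1 : Fin T) = 1 := by
    have hv := val_halfIndex_add_one (T := T) hp i
    rw [parityExtend_single hp, if_pos (by omega)]
  rw [halfHermite_apply, Pi.single_eq_of_ne hne, mul_zero, add_zero, h1]
  linarith [parityExtend_single_sub_one_nonneg (T := T) hp i j]

theorem halfHermite_eq_zero (hp : p ≤ 1) (i j : Fin (parityDim T p))
    (hij : (i : ℕ) + 1 < j ∨ (j : ℕ) + 1 < i) : halfHermite T hp i j = 0 := by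
  have hne : i ≠ j := fun h => by rw [h] at hij; omega
  have hi := i.2
  have hj := j.2
  have hv := val_halfIndex_add_one (T := T) hp i
  have hw := val_halfIndex_sub_one (T := T) hp i
  rw [halfHermite_apply, Pi.single_eq_of_ne hne, mul_zero, add_zero, parityExtend_single hp,
    parityExtend_single hp]
  generalize ((halfIndex hp i + 1 : Fin T) : ℕ) = v at hv ⊢
  generalize ((halfIndex hp i - 1 : Fin T) : ℕ) = w at hw ⊢
  unfold parityDim at hi hj
  rw [if_neg (by omega), if_neg (by omega), if_neg (by omega), if_neg (by omega), add_zero]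

end

/-! ### The cosine and sine transforms -/

/-- `cos` for `p = 0` and `sin` for `p = 1`. -/
def wave (p : ℕ) (t : ℝ) : ℝ := if p = 0 then Real.cos t else Real.sin t

theorem wave_neg {p : ℕ} (hp : p ≤ 1) (t : ℝ) : wave p (-t) = (-1) ^ p * wave p t := by
  interval_cases p <;> simp [wave]

theorem wave_add_add_wave_sub (p : ℕ) (t s : ℝ) :
    wave p (t + s) + wave p (t - s) = 2 * Real.cos s * wave p t := by
  unfold wave
  split_ifs
  · rw [Real.cos_add, Real.cos_sub]; ring
  · rw [Real.sin_add, Real.sin_sub]; ring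

theorem wave_mul_wave {p : ℕ} (hp : p ≤ 1) (s t : ℝ) :
    wave p s * wave p t = (Real.cos (s - t) + (-1) ^ p * Real.cos (s + t)) / 2 := by
  interval_cases p <;> simp only [wave, Real.cos_add, Real.cos_sub]
  · norm_num
  · norm_num
    ring

theorem wave_add_int_mul_two_pi (p : ℕ) (t : ℝ) (k : ℤ) :
    wave p (t + k * (2 * Real.pi)) = wave p t := by
  unfold wave
  split_ifs
  · exact Real.cos_add_int_mul_two_pi t k
  · exact Real.sin_add_int_mul_two_pi t k

theorem wave_congr {T : ℕ} [NeZero T] (p : ℕ) {a b : ℤ} (h : a ≡ b [ZMOD T]) (n : ℕ) :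
    wave p (2 * Real.pi * a * n / T) = wave p (2 * Real.pi * b * n / T) := by
  have hT : (T : ℝ) ≠ 0 := Nat.cast_ne_zero.mpr (NeZero.ne T)
  obtain ⟨c, hc⟩ := h.symm.dvd
  have : (a : ℝ) = b + T * c := by
    rw [← sub_eq_iff_eq_add']; exact_mod_cast hc
  rw [← wave_add_int_mul_two_pi p (2 * Real.pi * b * n / T) (c * n), this]
  congr 1
  push_cast
  field_simp

theorem sum_cos_two_pi {T : ℕ} [NeZero T] (a : ℤ) :
    ∑ n : Fin T, Real.cos (2 * Real.pi * a * (n : ℕ) / T) = if (T : ℤ) ∣ a then (T : ℝ) else 0 := by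
  have hT : (T : ℂ) ≠ 0 := Nat.cast_ne_zero.mpr (NeZero.ne T)
  have hT' : (T : ℝ) ≠ 0 := Nat.cast_ne_zero.mpr (NeZero.ne T)
  set z : ℂ := Complex.exp (2 * Real.pi * Complex.I * (a / T)) with hz
  have hre : ∀ n : ℕ, Real.cos (2 * Real.pi * a * n / T) = (z ^ n).re := by
    intro n
    rw [hz, ← Complex.exp_nat_mul, ← Complex.exp_ofReal_mul_I_re]
    congr 2
    push_cast
    field_simp
  have hzT : z ^ T = 1 := by
    rw [hz, ← Complex.exp_nat_mul, Complex.exp_eq_one_iff]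
    exact ⟨a, by field_simp⟩
  simp_rw [hre]
  rw [← Complex.re_sum, Fin.sum_univ_eq_sum_range (fun n => z ^ n)]
  split_ifs with h
  · obtain ⟨c, hc⟩ := h
    have : z = 1 := by
      rw [hz, Complex.exp_eq_one_iff]
      refine ⟨c, ?_⟩
      rw [hc]
      push_cast
      field_simp
    simp [this]
  · have : z ≠ 1 := by
      intro hz1
      rw [hz, Complex.exp_eq_one_iff] at hz1
      obtain ⟨c, hc⟩ := hz1
      refine h ⟨c, ?_⟩
      have h2 : (2 * Real.pi * Complex.I : ℂ) ≠ 0 := Complex.two_pi_I_ne_zero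
      rw [mul_comm (c : ℂ)] at hc
      have h3 := mul_left_cancel₀ h2 hc
      rw [div_eq_iff hT] at h3
      rw [mul_comm]
      exact_mod_cast h3
    rw [geom_sum_eq this, hzT]
    simp

/-- The matrix of the normalized cosine (`p = 0`) or sine (`p = 1`) transform. -/
def waveMatrix (T p : ℕ) : Matrix (Fin T) (Fin T) ℝ :=
  Matrix.of fun m n => 1 / Real.sqrt T * wave p (2 * Real.pi * (m : ℕ) * (n : ℕ) / T)

section

variable {T p : ℕ}

theorem waveMatrix_comm (m n : Fin T) : waveMatrix T p m n = waveMatrix T p n m := by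
  simp only [waveMatrix, Matrix.of_apply]
  congr 3
  ring

variable [NeZero T]

theorem waveMatrix_eq_of_modEq (m n : Fin T) {a : ℤ} (h : ((m : ℕ) : ℤ) ≡ a [ZMOD T]) :
    waveMatrix T p m n = 1 / Real.sqrt T * wave p (2 * Real.pi * a * (n : ℕ) / T) := by
  rw [← wave_congr p h, waveMatrix, Matrix.of_apply, Int.cast_natCast]

theorem val_add_one_modEq (m : Fin T) : (((m + 1 : Fin T) : ℕ) : ℤ) ≡ (m : ℕ) + 1 [ZMOD T] := by
  rw [val_add_one_mod]
  split_ifs with h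
  · refine (Int.modEq_iff_dvd.2 ⟨1, ?_⟩)
    push_cast
    omega
  · push_cast; rfl

theorem val_sub_one_modEq (m : Fin T) : (((m - 1 : Fin T) : ℕ) : ℤ) ≡ (m : ℕ) - 1 [ZMOD T] := by
  have := (val_add_one_modEq (m - 1)).symm.sub_right 1
  simpa using this

theorem val_neg_modEq (m : Fin T) : (((-m : Fin T) : ℕ) : ℤ) ≡ -(m : ℕ) [ZMOD T] := by
  have := m.2
  rw [val_neg_mod]
  split_ifs with h
  · simp [h]
  · refine (Int.modEq_iff_dvd.2 ⟨-1, ?_⟩)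
    push_cast [this.le]
    ring

theorem waveMatrix_neg (hp : p ≤ 1) (m n : Fin T) :
    waveMatrix T p (-m) n = (-1) ^ p * waveMatrix T p m n := by
  rw [waveMatrix_eq_of_modEq _ _ (val_neg_modEq m), waveMatrix_eq_of_modEq m n rfl,
    mul_left_comm, ← wave_neg hp]
  congr 2
  push_cast
  ring

theorem hermiteMatrix_mul_waveMatrix_apply (m n : Fin T) :
    (hermiteMatrix T * waveMatrix T p) m n =
      (2 * Real.cos (2 * Real.pi * (n : ℕ) / T) + 2 * Real.cos (2 * Real.pi * (m : ℕ) / T) - 4) *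
        waveMatrix T p m n := by
  have h : (hermiteMatrix T * waveMatrix T p) m n =
      waveMatrix T p (m + 1) n + waveMatrix T p (m - 1) n +
        (2 * Real.cos (2 * Real.pi * (m : ℕ) / T) - 4) * waveMatrix T p m n := by
    rw [← hermiteOp_apply T (WithLp.toLp 2 fun m => waveMatrix T p m n)]
    rfl
  rw [h, waveMatrix_eq_of_modEq _ _ (val_add_one_modEq m),
    waveMatrix_eq_of_modEq _ _ (val_sub_one_modEq m), waveMatrix_eq_of_modEq m n rfl, ← mul_add]
  have e := wave_add_add_wave_sub p (2 * Real.pi * (m : ℕ) * (n : ℕ) / T)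
    (2 * Real.pi * (n : ℕ) / T)
  push_cast
  rw [show 2 * Real.pi * ((m : ℕ) + 1 : ℝ) * (n : ℕ) / T =
      2 * Real.pi * (m : ℕ) * (n : ℕ) / T + 2 * Real.pi * (n : ℕ) / T by ring,
    show 2 * Real.pi * ((m : ℕ) - 1 : ℝ) * (n : ℕ) / T =
      2 * Real.pi * (m : ℕ) * (n : ℕ) / T - 2 * Real.pi * (n : ℕ) / T by ring, e]
  ring

/-- The entrywise formula is symmetric in `m` and `n`; a product of two symmetric matrices that is
itself symmetric is a commuting product. -/
theorem hermiteMatrix_mul_waveMatrix :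
    hermiteMatrix T * waveMatrix T p = waveMatrix T p * hermiteMatrix T := by
  have hS : (hermiteMatrix T)ᵀ = hermiteMatrix T := by
    simpa [Matrix.IsHermitian, conjTranspose_eq_transpose_of_trivial] using
      hermiteMatrix_isHermitian T
  have hK : (waveMatrix T p)ᵀ = waveMatrix T p := by
    ext m n; exact waveMatrix_comm n m
  have h : (hermiteMatrix T * waveMatrix T p)ᵀ = hermiteMatrix T * waveMatrix T p := by
    ext m n
    rw [transpose_apply, hermiteMatrix_mul_waveMatrix_apply, hermiteMatrix_mul_waveMatrix_apply,
      waveMatrix_comm]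
    ring
  rw [← h, transpose_mul, hS, hK]

/-- The square is the projection onto parity `p`, by the product-to-sum formula and orthogonality of
the characters. -/
theorem waveMatrix_mul_self_apply (hp : p ≤ 1) (m l : Fin T) :
    (waveMatrix T p * waveMatrix T p) m l =
      ((if m = l then 1 else 0) + (-1) ^ p * (if -m = l then 1 else 0)) / 2 := by
  have hT : (T : ℝ) ≠ 0 := Nat.cast_ne_zero.mpr (NeZero.ne T)
  have hsq : 1 / Real.sqrt T * (1 / Real.sqrt T) = 1 / (T : ℝ) := by
    rw [div_mul_div_comm, Real.mul_self_sqrt (Nat.cast_nonneg T), one_mul]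
  have hterm : ∀ n : Fin T, waveMatrix T p m n * waveMatrix T p n l =
      1 / (T : ℝ) * ((Real.cos (2 * Real.pi * (((m : ℕ) - (l : ℕ) : ℤ)) * (n : ℕ) / T) +
        (-1) ^ p * Real.cos (2 * Real.pi * (((m : ℕ) + (l : ℕ) : ℤ)) * (n : ℕ) / T)) / 2) := by
    intro n
    rw [waveMatrix_comm n l, ← hsq]
    simp only [waveMatrix, Matrix.of_apply]
    rw [mul_mul_mul_comm, wave_mul_wave hp]
    congr 5
    · push_cast; ring
    · push_cast; ring_nf
  rw [mul_apply, Finset.sum_congr rfl fun n _ => hterm n, ← Finset.mul_sum, ← Finset.sum_div,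
    Finset.sum_add_distrib, ← Finset.mul_sum, sum_cos_two_pi, sum_cos_two_pi]
  have hm := m.2
  have hl := l.2
  have e1 : (T : ℤ) ∣ (m : ℕ) - (l : ℕ) ↔ m = l := by
    constructor
    · intro h
      have := Int.eq_zero_of_abs_lt_dvd h (by rw [abs_lt]; omega)
      exact Fin.ext (by omega)
    · rintro rfl; simp
  have e2 : (T : ℤ) ∣ (m : ℕ) + (l : ℕ) ↔ -m = l := by
    have h1 := val_neg_modEq m
    have hn := (-m).2
    constructor
    · intro h
      have h2 : (((-m : Fin T) : ℕ) : ℤ) ≡ (l : ℕ) [ZMOD T] :=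
        h1.trans (Int.modEq_iff_dvd.2 (by convert h using 1; ring))
      have h3 := Int.eq_zero_of_abs_lt_dvd h2.dvd (by rw [abs_lt]; omega)
      exact Fin.ext (by omega)
    · rintro rfl
      have := h1.symm.dvd
      simpa [sub_neg_eq_add, add_comm] using this
  simp only [e1, e2]
  split_ifs <;> field_simp <;> ring

theorem waveMatrix_mulVec_mulVec (hp : p ≤ 1) {x : EuclideanSpace ℝ (Fin T)}
    (hx : x ∈ paritySpace T p) : waveMatrix T p *ᵥ (waveMatrix T p *ᵥ x) = x := by
  rw [mulVec_mulVec]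
  ext m
  have hxm : x (-m) = (-1) ^ p * x m := hx m
  simp only [mulVec, dotProduct, waveMatrix_mul_self_apply hp]
  have : ∀ l : Fin T, ((if m = l then 1 else 0) + (-1) ^ p * (if -m = l then 1 else 0)) / 2 * x l =
      (if m = l then x l / 2 else 0) + (if -m = l then (-1) ^ p * x l / 2 else 0) := by
    intro l
    split_ifs <;> ring
  simp_rw [this]
  rw [Finset.sum_add_distrib, Finset.sum_ite_eq, Finset.sum_ite_eq]
  simp only [Finset.mem_univ, if_true, hxm, ← mul_assoc, ← mul_pow]
  norm_num

end

/-! ### The discrete Hermite-Gaussians diagonalize the cosine and sine transforms -/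

/-- An operator commuting with `S` preserves its eigenspaces, which are lines when the eigenvalues
are distinct. -/
theorem apply_eigenvectorBasis_of_commute {E : Type*} [NormedAddCommGroup E]
    [InnerProductSpace ℝ E] [FiniteDimensional ℝ E] {d : ℕ} {S K : E →ₗ[ℝ] E}
    (hS : S.IsSymmetric) (hd : Module.finrank ℝ E = d)
    (hinj : Function.Injective (hS.eigenvalues hd)) (hSK : ∀ x, S (K x) = K (S x)) (i : Fin d) :
    K (hS.eigenvectorBasis hd i) =
      inner ℝ (hS.eigenvectorBasis hd i) (K (hS.eigenvectorBasis hd i)) •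
        hS.eigenvectorBasis hd i := by
  set U := hS.eigenvectorBasis hd
  have h0 : ∀ j, j ≠ i → inner ℝ (U j) (K (U i)) = 0 := by
    intro j hj
    have h1 := hS (U j) (K (U i))
    rw [hSK, hS.apply_eigenvectorBasis, hS.apply_eigenvectorBasis, map_smul, real_inner_smul_left,
      real_inner_smul_right] at h1
    by_contra hne
    exact hj (hinj (by simpa using mul_right_cancel₀ hne h1))
  conv_lhs => rw [← U.sum_repr (K (U i))]
  rw [Finset.sum_eq_single i (fun j _ hj => by rw [U.repr_apply_apply, h0 j hj, zero_smul])
    (by simp), U.repr_apply_apply]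

section

variable {T p : ℕ} [NeZero T]

theorem waveMatrix_mem_paritySpace (hp : p ≤ 1) (n : Fin T) :
    (WithLp.toLp 2 fun m => waveMatrix T p m n) ∈ paritySpace T p :=
  fun m => waveMatrix_neg hp m n

theorem toEuclideanLin_waveMatrix_mem (hp : p ≤ 1) (x : EuclideanSpace ℝ (Fin T)) :
    toEuclideanLin (waveMatrix T p) x ∈ paritySpace T p := by
  intro n
  simp only [toLpLin_apply, mulVec, dotProduct, waveMatrix_neg hp, Finset.mul_sum, mul_assoc]

/-- The cosine (`p = 0`) or sine (`p = 1`) transform on the signals of parity `p`. -/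
def waveOp (T : ℕ) [NeZero T] {p : ℕ} (hp : p ≤ 1) : paritySpace T p →ₗ[ℝ] paritySpace T p :=
  (toEuclideanLin (waveMatrix T p)).restrict fun x _ => toEuclideanLin_waveMatrix_mem hp x

theorem waveOp_apply (hp : p ≤ 1) (x : paritySpace T p) (m : Fin T) :
    (waveOp T hp x : EuclideanSpace ℝ (Fin T)) m =
      (waveMatrix T p *ᵥ (x : EuclideanSpace ℝ (Fin T)).ofLp) m := rfl

theorem hermiteOpParity_waveOp (hp : p ≤ 1) (x : paritySpace T p) :
    hermiteOpParity T p (waveOp T hp x) = waveOp T hp (hermiteOpParity T p x) := by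
  ext m
  change (hermiteMatrix T *ᵥ (waveMatrix T p *ᵥ x.1.ofLp)) m =
    (waveMatrix T p *ᵥ (hermiteMatrix T *ᵥ x.1.ofLp)) m
  rw [mulVec_mulVec, mulVec_mulVec, hermiteMatrix_mul_waveMatrix]

theorem waveOp_waveOp (hp : p ≤ 1) (x : paritySpace T p) : waveOp T hp (waveOp T hp x) = x := by
  ext m
  exact congrFun (waveMatrix_mulVec_mulVec hp x.2) m

/-- The orthonormal basis of eigenvectors of `S` on the signals of parity `p`. -/
def hermiteBasis (T : ℕ) [NeZero T] {p : ℕ} (hp : p ≤ 1) :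
    OrthonormalBasis (Fin (parityDim T p)) ℝ (paritySpace T p) :=
  (hermiteOpParity_isSymmetric T p).eigenvectorBasis (finrank_paritySpace hp)

/-- The eigenvalues of `S` on the signals of parity `p`, in decreasing order. -/
def hermiteEigenvalues (T : ℕ) [NeZero T] {p : ℕ} (hp : p ≤ 1) : Fin (parityDim T p) → ℝ :=
  (hermiteOpParity_isSymmetric T p).eigenvalues (finrank_paritySpace hp)

/-- The values of the eigenvectors of `S` on half a period. -/
def hermiteBasisMatrix (T : ℕ) [NeZero T] {p : ℕ} (hp : p ≤ 1) :
    Matrix (Fin (parityDim T p)) (Fin (parityDim T p)) ℝ :=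
  Matrix.of fun n i => halfEquiv hp (hermiteBasis T hp i) n

theorem halfHermite_mul_hermiteBasisMatrix (hp : p ≤ 1) :
    halfHermite T hp * hermiteBasisMatrix T hp =
      hermiteBasisMatrix T hp * diagonal (hermiteEigenvalues T hp) := by
  ext n i
  have h := congrFun (halfHermite_mulVec hp (hermiteBasis T hp i)) n
  have e : hermiteOpParity T p (hermiteBasis T hp i) =
      hermiteEigenvalues T hp i • hermiteBasis T hp i :=
    (hermiteOpParity_isSymmetric T p).apply_eigenvectorBasis (finrank_paritySpace hp) i
  rw [e, map_smul] at h
  rw [mul_diagonal, mul_comm (hermiteBasisMatrix T hp n i)]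
  exact h

theorem det_hermiteBasisMatrix_ne_zero (hp : p ≤ 1) : (hermiteBasisMatrix T hp).det ≠ 0 := by
  intro h
  obtain ⟨c, hc, hc0⟩ := exists_mulVec_eq_zero_iff.2 h
  refine hc (funext fun i => ?_)
  have h1 : halfEquiv hp (∑ i, c i • hermiteBasis T hp i) = 0 := by
    rw [map_sum, ← hc0]
    ext n
    simp [mulVec, dotProduct, hermiteBasisMatrix, mul_comm]
  rw [map_eq_zero_iff _ (halfEquiv hp).injective] at h1
  exact Fintype.linearIndependent_iff.1 (hermiteBasis T hp).toBasis.linearIndependent c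
    (by simpa using h1) i

theorem hermiteEigenvalues_injective (hp : p ≤ 1) :
    Function.Injective (hermiteEigenvalues T hp) := by
  intro i j h
  have : NeZero (parityDim T p) := ⟨by have := i.2; omega⟩
  exact eigenvalue_injective (halfHermite_ne_zero hp)
    (fun a b hab => halfHermite_eq_zero hp a b (.inl hab)) (halfHermite_mul_hermiteBasisMatrix hp)
    (det_hermiteBasisMatrix_ne_zero hp) h

/-- The eigenvalues of the cosine or sine transform at the discrete Hermite-Gaussians. -/
def waveEigenvalue (T : ℕ) [NeZero T] {p : ℕ} (hp : p ≤ 1) (i : Fin (parityDim T p)) : ℝ :=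
  inner ℝ (hermiteBasis T hp i) (waveOp T hp (hermiteBasis T hp i))

theorem waveOp_hermiteBasis (hp : p ≤ 1) (i : Fin (parityDim T p)) :
    waveOp T hp (hermiteBasis T hp i) = waveEigenvalue T hp i • hermiteBasis T hp i :=
  apply_eigenvectorBasis_of_commute _ _ (hermiteEigenvalues_injective hp)
    (hermiteOpParity_waveOp hp) i

theorem waveEigenvalue_mul_self (hp : p ≤ 1) (i : Fin (parityDim T p)) :
    waveEigenvalue T hp i * waveEigenvalue T hp i = 1 := by
  have h := waveOp_waveOp hp (hermiteBasis T hp i)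
  rw [waveOp_hermiteBasis, map_smul, waveOp_hermiteBasis, smul_smul] at h
  have h1 := congrArg (inner ℝ (hermiteBasis T hp i)) h
  rw [real_inner_smul_right, real_inner_self_eq_norm_sq, (hermiteBasis T hp).norm_eq_one] at h1
  simpa using h1

/-- Column `n` has parity `p`, and by symmetry of the matrix its inner product with an eigenvector
is the value at `n` of the transformed eigenvector. -/
theorem waveMatrix_eq_sum (hp : p ≤ 1) (m n : Fin T) :
    waveMatrix T p m n = ∑ i, waveEigenvalue T hp i *
      ((hermiteBasis T hp i : EuclideanSpace ℝ (Fin T)) m *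
        (hermiteBasis T hp i : EuclideanSpace ℝ (Fin T)) n) := by
  set w : paritySpace T p :=
    ⟨WithLp.toLp 2 fun m => waveMatrix T p m n, waveMatrix_mem_paritySpace hp n⟩ with hw
  have h1 : ∀ i, inner ℝ (hermiteBasis T hp i) w =
      waveEigenvalue T hp i * (hermiteBasis T hp i : EuclideanSpace ℝ (Fin T)) n := by
    intro i
    have h2 : (waveOp T hp (hermiteBasis T hp i) : EuclideanSpace ℝ (Fin T)) n =
        waveEigenvalue T hp i * (hermiteBasis T hp i : EuclideanSpace ℝ (Fin T)) n := by
      rw [waveOp_hermiteBasis]; rfl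
    rw [← h2, waveOp_apply, Submodule.coe_inner, PiLp.inner_apply]
    refine Finset.sum_congr rfl fun m _ => ?_
    change _ = waveMatrix T p n m * _
    rw [waveMatrix_comm n m]
    rfl
  have h3 := congrArg (fun x : paritySpace T p => (x : EuclideanSpace ℝ (Fin T)) m)
    ((hermiteBasis T hp).sum_repr w)
  simp only [OrthonormalBasis.repr_apply_apply, h1] at h3
  rw [show waveMatrix T p m n = (w : EuclideanSpace ℝ (Fin T)) m from rfl, ← h3,
    Submodule.coe_sum, WithLp.ofLp_sum, Finset.sum_apply]
  refine Finset.sum_congr rfl fun i _ => ?_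
  simp only [Submodule.coe_smul, PiLp.smul_apply, smul_eq_mul]
  ring

/-- The Chebyshev polynomials of the first (`p = 0`) or second (`p = 1`) kind. -/
def wavePolynomial (p n : ℕ) : ℝ[X] :=
  if p = 0 then Chebyshev.T ℝ n else Chebyshev.U ℝ n

theorem wave_nat_mul (hp : p ≤ 1) (n : ℕ) (t : ℝ) :
    wave p ((n + p : ℕ) * t) =
      (if p = 0 then 1 else Real.sin t) * (wavePolynomial p n).eval (Real.cos t) := by
  interval_cases p
  · have := Chebyshev.T_real_cos t n
    simp [wave, wavePolynomial, this]
  · have := Chebyshev.U_real_cos t n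
    push_cast at this
    simp only [wave, wavePolynomial, one_ne_zero, if_false]
    push_cast
    rw [← this, mul_comm]

theorem waveEigenvalue_eq (hp : p ≤ 1) (i : Fin (parityDim T p)) :
    waveEigenvalue T hp i = (-1) ^ (i : ℕ) := by
  have hT : (0 : ℝ) < T := Nat.cast_pos.2 (Nat.pos_of_ne_zero (NeZero.ne T))
  set t : Fin (parityDim T p) → ℝ := fun n => 2 * Real.pi * ((n : ℕ) + p : ℕ) / T with ht
  have ht0 : ∀ n, 0 ≤ t n := fun n => by rw [ht]; positivity
  -- On half a period the angles stay in `[0, π]`, where cosine is strictly decreasing and sine is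
  -- nonnegative.
  have htpi : ∀ n, t n ≤ Real.pi := by
    intro n
    have hn := n.2
    have h2 : 2 * ((n : ℕ) + p) ≤ T := by
      have h3 : T ≠ 0 := NeZero.ne T
      unfold parityDim at hn
      omega
    have h3 : (2 * (((n : ℕ) + p : ℕ) : ℝ)) ≤ T := by exact_mod_cast h2
    rw [ht]
    simp only
    rw [div_le_iff₀ hT]
    nlinarith [Real.pi_pos]
  refine sign_eq_neg_one_pow (x := fun n => Real.cos (t n))
    (g := fun n => 1 / Real.sqrt T * if p = 0 then 1 else Real.sin (t n))
    (p := wavePolynomial p)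
    (halfHermite_nonneg hp) (halfHermite_ne_zero hp) (halfHermite_eq_zero hp)
    (halfHermite_mul_hermiteBasisMatrix hp) (det_hermiteBasisMatrix_ne_zero hp)
    ((hermiteOpParity_isSymmetric T p).eigenvalues_antitone (finrank_paritySpace hp))
    (waveEigenvalue_mul_self hp) (fun n => ?_) (fun n => ?_) (fun a b hab => ?_) (fun n => ?_)
    (fun m n => ?_) i
  · unfold wavePolynomial
    split_ifs
    · simp
    · simp
  · unfold wavePolynomial
    split_ifs
    · rw [Chebyshev.leadingCoeff_T]; positivity
    · rw [Chebyshev.leadingCoeff_U_natCast]; positivity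
  · refine Real.strictAntiOn_cos ⟨ht0 a, htpi a⟩ ⟨ht0 b, htpi b⟩ ?_
    have : (((a : ℕ) + p : ℕ) : ℝ) < ((b : ℕ) + p : ℕ) := by
      exact_mod_cast Nat.add_lt_add_right hab p
    simp only [ht]
    gcongr
  · refine mul_nonneg (by positivity) ?_
    split_ifs
    · exact zero_le_one
    · exact Real.sin_nonneg_of_nonneg_of_le_pi (ht0 n) (htpi n)
  · have h1 : (hermiteBasisMatrix T hp * diagonal (waveEigenvalue T hp) *
        (hermiteBasisMatrix T hp)ᵀ) m n = waveMatrix T p (halfIndex hp m) (halfIndex hp n) := by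
      rw [waveMatrix_eq_sum hp, mul_apply]
      refine Finset.sum_congr rfl fun i _ => ?_
      rw [mul_diagonal, transpose_apply, mul_comm (hermiteBasisMatrix T hp m i), mul_assoc]
      rfl
    rw [h1, mul_assoc, ← wave_nat_mul hp, waveMatrix, Matrix.of_apply]
    congr 2
    simp only [halfIndex, ht]
    ring

end

/-! ### The fractional transforms of order one -/

/-- Transports the eigenbasis between equal subspaces: `paritySpace T k` depends on `k` only through
its parity, but not definitionally. -/
theorem eigenvectorBasis_restrict_congr {E : Type*} [NormedAddCommGroup E]
    [InnerProductSpace ℝ E] [FiniteDimensional ℝ E] {S : E →ₗ[ℝ] E} {W W' : Submodule ℝ E}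
    (h : W = W') {hW : ∀ x ∈ W, S x ∈ W} {hW' : ∀ x ∈ W', S x ∈ W'}
    (hs : (S.restrict hW).IsSymmetric) (hs' : (S.restrict hW').IsSymmetric) {d : ℕ}
    (hd : Module.finrank ℝ W' = d) {i : ℕ} (hi : i < Module.finrank ℝ W) (hi' : i < d) :
    (hs.eigenvectorBasis rfl ⟨i, hi⟩ : E) = hs'.eigenvectorBasis hd ⟨i, hi'⟩ := by
  subst h hd
  rfl

section

variable {T p : ℕ} [NeZero T]

theorem paritySpace_two_mul_add (T : ℕ) [NeZero T] (i p : ℕ) :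
    paritySpace T (2 * i + p) = paritySpace T p := by
  ext x
  change (∀ n, _) ↔ (∀ n, _)
  simp [pow_add, pow_mul]

theorem discreteHermiteGaussian_two_mul_add (hp : p ≤ 1) (i : Fin (parityDim T p)) :
    discreteHermiteGaussian T (2 * i + p) = hermiteBasis T hp i := by
  have e : (2 * (i : ℕ) + p) / 2 = i := by omega
  have h : (2 * (i : ℕ) + p) / 2 < Module.finrank ℝ (paritySpace T (2 * i + p)) := by
    rw [paritySpace_two_mul_add, finrank_paritySpace hp, e]
    exact i.2
  rw [discreteHermiteGaussian, dif_pos h]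
  refine (eigenvectorBasis_restrict_congr (paritySpace_two_mul_add T i p) _
    (hermiteOpParity_isSymmetric T p) (finrank_paritySpace hp) h (by rw [e]; exact i.2)).trans ?_
  simp only [e]
  rfl

/-- The skipped index is `T - 1` for even `T` and `T` for odd `T`; what remains has exactly as many
even and odd indices as the dimensions of the two parity classes. -/
theorem sum_hermite_indices {M : Type*} [AddCommMonoid M] (f : ℕ → M) :
    ∑ k ∈ (Finset.range (T + 1)).erase (T - 1 + T % 2), f k =
      (∑ i : Fin (parityDim T 0), f (2 * i + 0)) + ∑ i : Fin (parityDim T 1), f (2 * i + 1) := by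
  have hT : T ≠ 0 := NeZero.ne T
  have e : (Finset.range (T + 1)).erase (T - 1 + T % 2) =
      (Finset.range (parityDim T 0)).image (fun i => 2 * i + 0) ∪
        (Finset.range (parityDim T 1)).image (fun i => 2 * i + 1) := by
    ext k
    simp only [Finset.mem_erase, Finset.mem_range, Finset.mem_union, Finset.mem_image, parityDim]
    constructor
    · rintro ⟨h1, h2⟩
      rcases Nat.even_or_odd' k with ⟨c, rfl | rfl⟩
      · exact .inl ⟨c, by omega, rfl⟩
      · exact .inr ⟨c, by omega, rfl⟩
    · rintro (⟨c, hc, rfl⟩ | ⟨c, hc, rfl⟩) <;> omega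
  rw [e, Finset.sum_union, Finset.sum_image (by intro a _ b _ h; simp only at h; omega),
    Finset.sum_image (by intro a _ b _ h; simp only at h; omega), Finset.sum_range,
    Finset.sum_range]
  rw [Finset.disjoint_left]
  simp only [Finset.mem_image]
  rintro _ ⟨a, -, rfl⟩ ⟨b, -, h⟩
  omega

theorem exp_hermite_index (i p : ℕ) :
    Complex.exp (-Complex.I * (Real.pi / 2) * ((2 * i + p : ℕ) : ℂ) * ((1 : ℝ) : ℂ)) =
      (-1) ^ i * (-Complex.I) ^ p := by
  have h : Complex.exp (-Complex.I * (Real.pi / 2)) = -Complex.I := by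
    rw [show -Complex.I * (Real.pi / 2) = -(Real.pi / 2 * Complex.I) by ring, Complex.exp_neg,
      Complex.exp_pi_div_two_mul_I, Complex.inv_I]
  rw [Complex.ofReal_one, mul_one, mul_comm, Complex.exp_nat_mul, h, pow_add, pow_mul]
  simp

theorem sum_discreteHermiteGaussian (hp : p ≤ 1) (m n : Fin T) :
    ∑ i : Fin (parityDim T p), (discreteHermiteGaussian T (2 * i + p) m : ℂ) *
      Complex.exp (-Complex.I * (Real.pi / 2) * ((2 * i + p : ℕ) : ℂ) * ((1 : ℝ) : ℂ)) *
        (discreteHermiteGaussian T (2 * i + p) n : ℂ) =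
      (-Complex.I) ^ p * (waveMatrix T p m n : ℂ) := by
  rw [waveMatrix_eq_sum hp, Complex.ofReal_sum, Finset.mul_sum]
  refine Finset.sum_congr rfl fun i _ => ?_
  rw [exp_hermite_index, discreteHermiteGaussian_two_mul_add hp, waveEigenvalue_eq hp]
  push_cast
  ring

theorem dfrtMatrix_one : dfrtMatrix T 1 = dftMatrix T := by
  ext m n
  rw [dfrtMatrix, Matrix.of_apply, sum_hermite_indices, sum_discreteHermiteGaussian zero_le_one,
    sum_discreteHermiteGaussian le_rfl, dftMatrix, Matrix.of_apply]
  simp only [waveMatrix, wave, Matrix.of_apply, if_true, one_ne_zero, if_false]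
  rw [show -Complex.I * 2 * Real.pi * (m : ℕ) * (n : ℕ) / T =
    ((-(2 * Real.pi * (m : ℕ) * (n : ℕ) / T) : ℝ) : ℂ) * Complex.I by push_cast; ring,
    Complex.exp_mul_I, ← Complex.ofReal_cos, ← Complex.ofReal_sin, Real.cos_neg, Real.sin_neg]
  push_cast
  ring

end

theorem jordanBlockPow_one (m : ℕ) (μ : ℂ) : jordanBlockPow m μ 1 = jordanBlock m μ := by
  ext a b
  simp only [jordanBlockPow, jordanBlock, Matrix.of_apply]
  by_cases h0 : a = b
  · subst h0; simp
  rw [if_neg h0]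
  have h0' : (a : ℕ) ≠ b := fun h => h0 (Fin.ext h)
  by_cases h1 : (a : ℕ) + 1 = b
  · have e : (b : ℕ) - a = 1 := by omega
    rw [if_pos (Fin.le_def.2 (by omega)), if_pos h1, e]
    simp
  · rw [if_neg h1]
    split_ifs with h2
    · have h2' : (a : ℕ) ≤ b := h2
      -- From the second superdiagonal on, the factor `n = 2` is `1 + 1 - 2 = 0`.
      rw [Finset.prod_eq_zero (i := 2) (Finset.mem_Icc.2 ⟨by omega, by omega⟩), zero_mul]
      norm_num
    · rfl

theorem gfrtMatrix_one {N : ℕ} {FG : Matrix (Fin N) (Fin N) ℂ} (D : JordanDecomposition FG) :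
    gfrtMatrix D 1 = FG := by
  simp only [gfrtMatrix, jordanBlockPow_one]
  exact D.eq_mul.symm

end JointFourier

end

theorem mainTheorem2 {N T : ℕ} [NeZero N] [NeZero T]
    (FG : Matrix (Fin N) (Fin N) ℂ) (hFG : IsUnit FG)
    (D : JointFourier.JordanDecomposition FG) (X : Matrix (Fin N) (Fin T) ℂ) :
    JointFourier.jfrt D 1 1 X = JointFourier.jft FG X := by
  rw [JointFourier.jfrt, JointFourier.jft, JointFourier.gfrtMatrix_one,
    JointFourier.dfrtMatrix_one]
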